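/- Let $V$ be a finite set of qubits and let $A\ne B$ be two of them. For a simple graph $G=(V,E)$ let $|G\rangle=\prod_{(i,j)\in E}CZ_{ij}\,|+\rangle^{\otimes V}$ be its graph state. A graph orbit is the set of all graph states on a given set of qubits that can be converted by single-qubit Clifford gates (up to normalization and global phase) into one fixed graph state. Let $\sigma^1,\sigma^2,\sigma^3,\sigma^4$ be elements of the single-qubit Pauli group such that $P=\sigma^1_A\sigma^2_B$ and $Q=\sigma^3_A\sigma^4_B$ are Hermitian and none of the operators $P$, $Q$, $PQ$ is a single-qubit operator (i.e. none of them acts on at most one of the two qubits; multiples of the identity count as single-qubit operators). It follows that $P$ and $Q$ commute. Let $O_1$ be a graph orbit on $V$ and $O_2$ a graph orbit on $V\setminus\{A,B\}$. Assume that there are $|G_1\rangle\in O_1$ and $|G_2\rangle\in O_2$ such that, when $P$ and $Q$ are measured on $|G_1\rangle$ and the qubits $A,B$ are discarded, the remaining qubits are, for some pair of measurement outcomes of non-zero probability, in the state $|G_2\rangle$ up to single-qubit Clifford gates. Then there exist graph states $|G_1'\rangle\in O_1$ and $|G_2'\rangle\in O_2$ such that measuring $X_AZ_B$ and $Z_AX_B$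 on $|G_1'\rangle$ and discarding $A,B$ leaves the remaining qubits, for every pair of measurement outcomes of non-zero probability, in the state $|G_2'\rangle$ up to single-qubit Clifford gates. -/

import Mathlib

open scoped Kronecker

noncomputable section

namespace GraphFusion

/-- Single-qubit operators in the computational basis `|0⟩, |1⟩`. -/
abbrev Op1 := Matrix (Fin 2) (Fin 2) ℂ

/-- Two-qubit operators; the first index belongs to qubit `A`, the second to qubit `B`. -/
abbrev Op2 := Matrix (Fin 2 × Fin 2) (Fin 2 × Fin 2) ℂ

/-- (Not necessarily normalized) vectors of the Hilbert space `⨂_{v ∈ V} ℂ²`, given by their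
amplitudes in the computational basis. -/
abbrev QState (V : Type*) := (V → Fin 2) → ℂ

/-! ### Pauli and Clifford operators -/

/-- The Pauli matrix `X = |0⟩⟨1| + |1⟩⟨0|`. -/
def pauliX : Op1 := !![0, 1; 1, 0]

/-- The Pauli matrix `Y = i|1⟩⟨0| - i|0⟩⟨1|`. -/
def pauliY : Op1 := !![0, -Complex.I; Complex.I, 0]

/-- The Pauli matrix `Z = |0⟩⟨0| - |1⟩⟨1|`. -/
def pauliZ : Op1 := !![1, 0; 0, -1]

/-- The single-qubit Pauli group `{i^k P : P ∈ {1, X, Y, Z}}`. -/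
def pauliGroup : Set Op1 :=
  {M | ∃ k : ℕ, ∃ P ∈ ({1, pauliX, pauliY, pauliZ} : Set Op1), M = Complex.I ^ k • P}

/-- Single-qubit Clifford gates: unitaries that map the Pauli group to itself by conjugation. -/
def IsClifford (U : Op1) : Prop :=
  U ∈ Matrix.unitaryGroup (Fin 2) ℂ ∧ ∀ P ∈ pauliGroup, U * P * star U ∈ pauliGroup

/-- The two-qubit operator acts on at most one of the two qubits (multiples of the identity
included). -/
def IsSingleQubit (M : Op2) : Prop :=
  ∃ U : Op1, M = U ⊗ₖ (1 : Op1) ∨ M = (1 : Op1) ⊗ₖ U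

/-! ### Graph states, local Clifford equivalence, graph orbits -/

section States

variable {V : Type*} [Fintype V] [DecidableEq V]

/-- The tensor product `⨂_v U_v` of single-qubit operators. -/
def localOp (U : V → Op1) : Matrix (V → Fin 2) (V → Fin 2) ℂ :=
  Matrix.of fun x y => ∏ v, U v (x v) (y v)

/-- Two states are local Clifford equivalent: one is the image of the other under a tensor product
of single-qubit Clifford gates, up to a non-zero scalar (normalization and global phase). -/
def LCEquiv (φ ψ : QState V) : Prop :=
  ∃ U : V → Op1, (∀ v, IsClifford (U v)) ∧
    ∃ c : ℂ, c ≠ 0 ∧ φ = c • (localOp U).mulVec ψ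

/-- The state `|+⟩^{⊗V}`. -/
def plusState (V : Type*) [Fintype V] : QState V :=
  fun _ => ((1 / Real.sqrt 2 : ℝ) : ℂ) ^ Fintype.card V

open Classical in
/-- The diagonal of the controlled-`Z` gate on the two endpoints of `e`: the basis state `|x⟩` gets
the sign `-1` exactly if both endpoints of `e` are in the state `|1⟩`. -/
def czDiag (e : Sym2 V) (x : V → Fin 2) : ℂ :=
  if ∀ v ∈ e, x v = 1 then -1 else 1

open Classical in
/-- The graph state `|G⟩ = ∏_{(i,j) ∈ E} CZ_{ij} |+⟩^{⊗V}`; the gates `CZ_{ij}` are diagonal, so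
their product is the pointwise product of the diagonals. -/
def graphState (G : SimpleGraph V) : QState V :=
  (Matrix.diagonal (∏ e ∈ G.edgeFinset, czDiag e)).mulVec (plusState V)

/-- A graph orbit: the set of all graphs whose graph states are local Clifford equivalent to the
graph state of some fixed graph. -/
def IsGraphOrbit (O : Set (SimpleGraph V)) : Prop :=
  ∃ G : SimpleGraph V, O = {H | LCEquiv (graphState H) (graphState G)}

/-! ### Fusions -/

/-- The qubits that remain after `A` and `B` have been destructively measured. -/
abbrev Rest (A B : V) : Type _ := {v : V // v ≠ A ∧ v ≠ B}

/-- The operator on all qubits that acts as `M` on the qubits `A, B` and as the identity on all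
others. -/
def onPair (A B : V) (M : Op2) : Matrix (V → Fin 2) (V → Fin 2) ℂ :=
  Matrix.of fun x y =>
    if ∀ v, v ≠ A → v ≠ B → x v = y v then M (x A, x B) (y A, y B) else 0

/-- The projector onto the eigenspace of the (Hermitian, involutive) operator `M` for the
eigenvalue `s = ±1`. -/
def outcomeProj (M : Op2) (s : ℤˣ) : Op2 :=
  (1 / 2 : ℂ) • (1 + ((s : ℤ) : ℂ) • M)

/-- The unnormalized state after the operators `P` and `Q` on the qubits `A, B` have been measured
on `ψ` with the outcomes `s` and `t`. Its squared norm is the probability of these outcomes. -/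
def projected (A B : V) (P Q : Op2) (s t : ℤˣ) (ψ : QState V) : QState V :=
  (onPair A B (outcomeProj P s * outcomeProj Q t)).mulVec ψ

/-- Measuring `P` and `Q` on the qubits `A, B` of `ψ` can have the outcomes `s, t`. -/
def Possible (A B : V) (P Q : Op2) (s t : ℤˣ) (ψ : QState V) : Prop :=
  projected A B P Q s t ψ ≠ 0

/-- The outcomes `s, t` are possible, and once they have occurred the measured qubits `A, B` are in
a product state with the remaining qubits, and the latter are in the state `φ` (up to a scalar). -/
def Leaves (A B : V) (P Q : Op2) (s t : ℤˣ) (ψ : QState V) (φ : QState (Rest A B)) : Prop :=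
  Possible A B P Q s t ψ ∧
    ∃ β : Fin 2 × Fin 2 → ℂ, ∀ x : V → Fin 2,
      projected A B P Q s t ψ x = β (x A, x B) * φ (fun v => x v.1)

/-- Measuring `P` and `Q` destructively on the qubits `A, B` of `|G⟩` can have the outcomes `s, t`,
and the remaining qubits are then in the state `|H⟩` up to local Clifford gates. -/
def FusesTo (A B : V) (P Q : Op2) (s t : ℤˣ) (G : SimpleGraph V)
    (H : SimpleGraph (Rest A B)) : Prop :=
  ∃ φ : QState (Rest A B), Leaves A B P Q s t (graphState G) φ ∧ LCEquiv φ (graphState H)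

end States

end GraphFusion

end

open GraphFusion

/-! A joint eigenvector of P and Q, conjugated and read as a 2×2 matrix K, turns the measurement
into a contraction of A and B with K (`Leaves.exists_fuse`). The eigenvalue equations say that Pauli
operators on the two sides of K fix it up to a scalar (`PauliRel`). Modulo phases the Pauli
operators form F₂², and since none of P, Q, PQ is single-qubit, the letters at A form a basis, and
so do those at B. Hence K encodes an element of GL₂(F₂) ≅ S₃, recorded by the partners b, d of X and
Z. The target fusion is the element that swaps X and Z.

Local complementation stays in the orbit of the graph. Absorbing its gates at A and B into K keeps
the fused state up to local Cliffords and multiplies the element by transvections: √X type at the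
vertex, phase type at its neighbours. If A, B are nonadjacent and one of them has an unshared
neighbour w, complementing at that qubit and at w moves only the letters of that qubit and preserves
the configuration. The two transvections generate GL₂(F₂), so the swap is reached. If A, B are
nonadjacent twins, complementing at A and B leads to the swap or to the identity. In the latter case
K is diagonal or off-diagonal and yields the induced graph on the remaining qubits, which for twins
is also what the target fusion yields.

If A and B are adjacent, complementing at a common neighbour removes the edge; an unshared neighbour
is first made common by complementing at its measured neighbour. Without further neighbours, A and B
factor off and the contraction only affects a scalar.

For nonadjacent A, B all outcomes of the target fusion give the same graph `fusedGraph` up to Z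
gates (`lcEquiv_fuse_bellCoeff`), so one matching outcome settles all of them. -/

namespace GraphFusion

/-! ### Pauli letters and the single-qubit Clifford group -/

/-- The Pauli operator `X ^ x * Z ^ z` with letter `(x, z)`. -/
def pauliOp (l : Fin 2 × Fin 2) : Op1 := pauliX ^ (l.1 : ℕ) * pauliZ ^ (l.2 : ℕ)

lemma pauliOp_mul (a c : Fin 2 × Fin 2) :
    ∃ k : ℕ, pauliOp a * pauliOp c = Complex.I ^ k • pauliOp (a + c) := by
  have key : pauliOp a * pauliOp c =
      -- Moving Z^(a.2) past X^(c.1) costs the sign (-1)^(a.2 * c.1), written as a power of i.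
      Complex.I ^ (2 * ((a.2 : ℕ) * (c.1 : ℕ))) • pauliOp (a + c) := by
    obtain ⟨a1, a2⟩ := a
    obtain ⟨c1, c2⟩ := c
    rw [pow_mul, Complex.I_sq]
    fin_cases a1 <;> fin_cases a2 <;> fin_cases c1 <;> fin_cases c2 <;>
      simp [pauliOp, pauliX, pauliZ, Matrix.one_fin_two]
  exact ⟨_, key⟩

lemma mem_pauliGroup_iff (M : Op1) :
    M ∈ pauliGroup ↔ ∃ (k : ℕ) (l : Fin 2 × Fin 2), M = Complex.I ^ k • pauliOp l := by
  have hY : pauliY = Complex.I • pauliOp (1, 1) := by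
    simp [pauliOp, pauliX, pauliY, pauliZ]
  constructor
  · rintro ⟨k, P, hP, rfl⟩
    rcases hP with rfl | rfl | rfl | rfl
    · exact ⟨k, (0, 0), by simp [pauliOp]⟩
    · exact ⟨k, (1, 0), by simp [pauliOp]⟩
    · exact ⟨k + 1, (1, 1), by rw [hY, smul_smul, pow_succ]⟩
    · exact ⟨k, (0, 1), by simp [pauliOp]⟩
  · rintro ⟨k, ⟨x, z⟩, rfl⟩
    fin_cases x <;> fin_cases z
    · exact ⟨k, 1, by simp, by simp [pauliOp]⟩
    · exact ⟨k, pauliZ, by simp, by simp [pauliOp]⟩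
    · exact ⟨k, pauliX, by simp, by simp [pauliOp]⟩
    · refine ⟨k + 3, pauliY, by simp, ?_⟩
      rw [hY, smul_smul, ← pow_succ, add_assoc, pow_add, Complex.I_pow_four, mul_one]
      rfl

lemma I_pow_smul_mem_pauliGroup (k : ℕ) {M : Op1} (hM : M ∈ pauliGroup) :
    Complex.I ^ k • M ∈ pauliGroup := by
  obtain ⟨j, P, hP, rfl⟩ := hM
  exact ⟨k + j, P, hP, by rw [smul_smul, pow_add]⟩

lemma mul_mem_pauliGroup {M N : Op1} (hM : M ∈ pauliGroup) (hN : N ∈ pauliGroup) :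
    M * N ∈ pauliGroup := by
  obtain ⟨j, a, rfl⟩ := (mem_pauliGroup_iff M).1 hM
  obtain ⟨k, c, rfl⟩ := (mem_pauliGroup_iff N).1 hN
  obtain ⟨m, hm⟩ := pauliOp_mul a c
  refine (mem_pauliGroup_iff _).2 ⟨j + k + m, a + c, ?_⟩
  rw [smul_mul_smul_comm, hm, smul_smul, pow_add, pow_add]

lemma finite_pauliGroup : pauliGroup.Finite := by
  refine (Set.finite_range fun p : Fin 4 × (Fin 2 × Fin 2) =>
    Complex.I ^ (p.1 : ℕ) • pauliOp p.2).subset ?_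
  intro M hM
  obtain ⟨k, l, rfl⟩ := (mem_pauliGroup_iff M).1 hM
  refine ⟨(⟨k % 4, Nat.mod_lt _ (by norm_num)⟩, l), ?_⟩
  simp only
  rw [Complex.I_pow_eq_pow_mod k]

lemma pauliOp_mem_pauliGroup (l : Fin 2 × Fin 2) : pauliOp l ∈ pauliGroup :=
  (mem_pauliGroup_iff _).2 ⟨0, l, by simp⟩

lemma pauliOp_mem_unitaryGroup (l : Fin 2 × Fin 2) :
    pauliOp l ∈ Matrix.unitaryGroup (Fin 2) ℂ := by
  have hX : pauliX ∈ Matrix.unitaryGroup (Fin 2) ℂ := by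
    rw [Matrix.mem_unitaryGroup_iff]
    ext i j
    fin_cases i <;> fin_cases j <;>
      simp [pauliX, Matrix.mul_apply, Fin.sum_univ_two, Matrix.star_apply]
  have hZ : pauliZ ∈ Matrix.unitaryGroup (Fin 2) ℂ := by
    rw [Matrix.mem_unitaryGroup_iff]
    ext i j
    fin_cases i <;> fin_cases j <;>
      simp [pauliZ, Matrix.mul_apply, Fin.sum_univ_two, Matrix.star_apply]
  exact mul_mem (pow_mem hX _) (pow_mem hZ _)

lemma mem_unitaryGroup_of_mem_pauliGroup {M : Op1} (hM : M ∈ pauliGroup) :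
    M ∈ Matrix.unitaryGroup (Fin 2) ℂ := by
  obtain ⟨k, l, rfl⟩ := (mem_pauliGroup_iff M).1 hM
  have h := Matrix.mem_unitaryGroup_iff.1 (pauliOp_mem_unitaryGroup l)
  rw [Matrix.mem_unitaryGroup_iff, star_smul, smul_mul_smul_comm, h, star_pow, ← mul_pow]
  simp

/-- Conjugation is multiplicative, and X and Z generate the Pauli group up to phases. -/
lemma isClifford_of_conj_X_Z {U : Op1} (hU : U ∈ Matrix.unitaryGroup (Fin 2) ℂ)
    (hX : U * pauliX * star U ∈ pauliGroup) (hZ : U * pauliZ * star U ∈ pauliGroup) :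
    IsClifford U := by
  refine ⟨hU, fun P hP => ?_⟩
  have hUU : U * star U = 1 := Matrix.mem_unitaryGroup_iff.1 hU
  have hUU' : star U * U = 1 := Matrix.mem_unitaryGroup_iff'.1 hU
  have h1 : (1 : Op1) ∈ pauliGroup := ⟨0, 1, by simp, by simp⟩
  obtain ⟨k, ⟨x, z⟩, rfl⟩ := (mem_pauliGroup_iff P).1 hP
  rw [Matrix.mul_smul, Matrix.smul_mul]
  refine I_pow_smul_mem_pauliGroup k ?_
  have hXZ : U * (pauliX * pauliZ) * star U =
      (U * pauliX * star U) * (U * pauliZ * star U) := by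
    calc U * (pauliX * pauliZ) * star U = U * pauliX * 1 * pauliZ * star U := by
          simp only [mul_assoc, one_mul]
      _ = _ := by rw [← hUU']; simp only [mul_assoc]
  fin_cases x <;> fin_cases z
  · simpa [pauliOp, hUU] using h1
  · simpa [pauliOp] using hZ
  · simpa [pauliOp] using hX
  · have := mul_mem_pauliGroup hX hZ
    rw [← hXZ] at this
    simpa [pauliOp] using this

lemma isClifford_one : IsClifford 1 := ⟨one_mem _, fun P hP => by simpa using hP⟩

lemma IsClifford.mul {U W : Op1} (hU : IsClifford U) (hW : IsClifford W) :
    IsClifford (U * W) := by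
  refine ⟨mul_mem hU.1 hW.1, fun P hP => ?_⟩
  have := hU.2 _ (hW.2 P hP)
  rw [star_mul]
  simpa only [mul_assoc] using this

lemma IsClifford.star {U : Op1} (hU : IsClifford U) : IsClifford (star U) := by
  have hUU' : Star.star U * U = 1 := Matrix.mem_unitaryGroup_iff'.1 hU.1
  refine ⟨Unitary.star_mem hU.1, fun P hP => ?_⟩
  have hcancel : ∀ Q, Star.star U * (U * Q * Star.star U) * U = Q := fun Q => by
    calc Star.star U * (U * Q * Star.star U) * U
        = (Star.star U * U) * Q * (Star.star U * U) := by simp only [mul_assoc]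
      _ = Q := by rw [hUU', one_mul, mul_one]
  -- Conjugation by U is an injective self-map of a finite set, hence onto, so the inverse
  -- conjugation preserves the set too.
  have hsurj : Set.SurjOn (fun Q => U * Q * Star.star U) pauliGroup pauliGroup := by
    refine (finite_pauliGroup.injOn_iff_bijOn_of_mapsTo (fun Q hQ => hU.2 Q hQ)).1 ?_ |>.surjOn
    intro Q _ Q' _ h
    rw [← hcancel Q, ← hcancel Q']
    exact congrArg (fun M => Star.star U * M * U) h
  obtain ⟨Q, hQ, rfl⟩ := hsurj hP
  rw [star_star]
  simpa only [hcancel] using hQ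

lemma isClifford_pauliZ : IsClifford pauliZ := by
  have hZ : pauliZ = pauliOp (0, 1) := by simp [pauliOp]
  have hX : pauliX = pauliOp (1, 0) := by simp [pauliOp]
  have hs : star pauliZ = pauliZ := by
    ext i j; fin_cases i <;> fin_cases j <;> simp [pauliZ, Matrix.star_apply]
  refine isClifford_of_conj_X_Z (hZ ▸ pauliOp_mem_unitaryGroup _) ?_ ?_
  · rw [hs, hZ, hX]
    exact mul_mem_pauliGroup (mul_mem_pauliGroup (pauliOp_mem_pauliGroup _)
      (pauliOp_mem_pauliGroup _)) (pauliOp_mem_pauliGroup _)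
  · rw [hs, hZ]
    exact mul_mem_pauliGroup (mul_mem_pauliGroup (pauliOp_mem_pauliGroup _)
      (pauliOp_mem_pauliGroup _)) (pauliOp_mem_pauliGroup _)

/-- The phase gate `diag(1, i)`. -/
noncomputable def phaseGate : Op1 := !![1, 0; 0, Complex.I]

/-- The adjoint of the square root of `X` with eigenvalues `1` and `i`. -/
noncomputable def sqrtXGate : Op1 :=
  (1 / 2 : ℂ) • !![1 - Complex.I, 1 + Complex.I; 1 + Complex.I, 1 - Complex.I]

lemma isClifford_phaseGate : IsClifford phaseGate := by
  refine isClifford_of_conj_X_Z ?_ ?_ ?_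
  · rw [Matrix.mem_unitaryGroup_iff]
    ext i j
    fin_cases i <;> fin_cases j <;>
      simp [phaseGate, Matrix.mul_apply, Fin.sum_univ_two, Matrix.star_apply]
  · refine ⟨0, pauliY, by simp, ?_⟩
    ext i j
    fin_cases i <;> fin_cases j <;>
      simp [phaseGate, pauliX, pauliY, Matrix.mul_apply, Fin.sum_univ_two, Matrix.star_apply]
  · refine ⟨0, pauliZ, by simp, ?_⟩
    ext i j
    fin_cases i <;> fin_cases j <;>
      simp [phaseGate, pauliZ, Matrix.mul_apply, Fin.sum_univ_two, Matrix.star_apply]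

lemma isClifford_sqrtXGate : IsClifford sqrtXGate := by
  refine isClifford_of_conj_X_Z ?_ ?_ ?_
  · rw [Matrix.mem_unitaryGroup_iff]
    ext i j
    fin_cases i <;> fin_cases j <;>
      simp [sqrtXGate, Matrix.mul_apply, Fin.sum_univ_two, Matrix.star_apply, Complex.ext_iff] <;>
      norm_num
  · refine ⟨0, pauliX, by simp, ?_⟩
    ext i j
    fin_cases i <;> fin_cases j <;>
      simp [sqrtXGate, pauliX, Matrix.mul_apply, Fin.sum_univ_two, Matrix.star_apply,
        Complex.ext_iff] <;>
      norm_num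
  · refine ⟨0, pauliY, by simp, ?_⟩
    ext i j
    fin_cases i <;> fin_cases j <;>
      simp [sqrtXGate, pauliY, pauliZ, Matrix.mul_apply, Fin.sum_univ_two, Matrix.star_apply,
        Complex.ext_iff] <;>
      norm_num

/-! ### Local Clifford equivalence -/

lemma localOp_one {V : Type*} [Fintype V] : localOp (fun _ : V => (1 : Op1)) = 1 := by
  ext x z
  simp only [localOp, Matrix.of_apply, Matrix.one_apply]
  by_cases h : x = z
  · simp [h]
  · rw [if_neg h]
    obtain ⟨v, hv⟩ := Function.ne_iff.1 h
    exact Finset.prod_eq_zero (Finset.mem_univ v) (by simp [hv])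

section LC

variable {V : Type*} [Fintype V] [DecidableEq V]

lemma localOp_mul (U W : V → Op1) : localOp U * localOp W = localOp fun v => U v * W v := by
  ext x z
  simp only [Matrix.mul_apply, localOp, Matrix.of_apply]
  rw [Finset.prod_univ_sum]
  simp only [Fintype.piFinset_univ, Finset.prod_mul_distrib]

lemma LCEquiv.of_smul {φ ψ : QState V} {c : ℂ} (hc : c ≠ 0) (h : φ = c • ψ) : LCEquiv φ ψ :=
  ⟨fun _ => 1, fun _ => isClifford_one, c, hc, by rw [localOp_one, Matrix.one_mulVec, h]⟩

lemma LCEquiv.refl (φ : QState V) : LCEquiv φ φ :=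
  .of_smul one_ne_zero (one_smul _ _).symm

lemma LCEquiv.trans {φ ψ χ : QState V} (h₁ : LCEquiv φ ψ) (h₂ : LCEquiv ψ χ) :
    LCEquiv φ χ := by
  obtain ⟨U, hU, c, hc, rfl⟩ := h₁
  obtain ⟨W, hW, d, hd, rfl⟩ := h₂
  refine ⟨fun v => U v * W v, fun v => (hU v).mul (hW v), c * d, mul_ne_zero hc hd, ?_⟩
  rw [← localOp_mul, Matrix.mulVec_smul, Matrix.mulVec_mulVec, smul_smul]

lemma LCEquiv.symm {φ ψ : QState V} (h : LCEquiv φ ψ) : LCEquiv ψ φ := by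
  obtain ⟨U, hU, c, hc, rfl⟩ := h
  refine ⟨fun v => star (U v), fun v => (hU v).star, c⁻¹, inv_ne_zero hc, ?_⟩
  have : (fun v => star (U v) * U v) = fun _ => (1 : Op1) :=
    funext fun v => Matrix.mem_unitaryGroup_iff'.1 (hU v).1
  rw [Matrix.mulVec_smul, Matrix.mulVec_mulVec, localOp_mul, this, localOp_one,
    Matrix.one_mulVec, smul_smul, inv_mul_cancel₀ hc, one_smul]

lemma LCEquiv.ne_zero {φ ψ : QState V} (h : LCEquiv φ ψ) (hψ : ψ ≠ 0) : φ ≠ 0 := by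
  rintro rfl
  obtain ⟨U, -, c, -, rfl⟩ := h.symm
  simp at hψ

end LC

end GraphFusion

namespace GraphFusion

/-! ### Graph states through their behaviour under bit flips -/

/-- The sign `(-1)^a` of a bit. -/
noncomputable def bitSign (a : Fin 2) : ℂ := (-1) ^ (a : ℕ)

@[simp] lemma bitSign_zero : bitSign 0 = 1 := by simp [bitSign]

@[simp] lemma bitSign_one : bitSign 1 = -1 := by simp [bitSign]

lemma bitSign_eq (a : Fin 2) : bitSign a = 1 ∨ bitSign a = -1 := by
  fin_cases a <;> simp

lemma fin_two_cases (a : Fin 2) : a = 0 ∨ a = 1 := by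
  fin_cases a <;> simp

section GraphStates

variable {V : Type*} [Fintype V]

open Classical in
/-- The sign `∏_{w ∼ v} (-1)^{x w}`. -/
noncomputable def nbrSign (G : SimpleGraph V) (v : V) (x : V → Fin 2) : ℂ :=
  ∏ w, if G.Adj v w then bitSign (x w) else 1

lemma nbrSign_eq (G : SimpleGraph V) (v : V) (x : V → Fin 2) :
    nbrSign G v x = 1 ∨ nbrSign G v x = -1 := by
  classical
  unfold nbrSign
  refine Finset.prod_induction _ (fun c : ℂ => c = 1 ∨ c = -1) ?_ (Or.inl rfl) ?_
  · rintro a b (rfl | rfl) (rfl | rfl) <;> simp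
  · intro w _
    split_ifs
    · exact bitSign_eq _
    · exact Or.inl rfl

lemma nbrSign_zero (G : SimpleGraph V) (v : V) : nbrSign G v 0 = 1 := by
  simp [nbrSign]

variable [DecidableEq V]

lemma prod_update_one (F : V → Fin 2 → ℂ) (u : V) (x : V → Fin 2) (hx : x u = 0)
    (hF : F u 0 = 1) :
    ∏ w, F w (Function.update x u 1 w) = F u 1 * ∏ w, F w (x w) := by
  rw [← Finset.mul_prod_erase Finset.univ _ (Finset.mem_univ u),
    ← Finset.mul_prod_erase Finset.univ (fun w => F w (x w)) (Finset.mem_univ u), hx, hF, one_mul,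
    Function.update_self]
  congr 1
  refine Finset.prod_congr rfl fun w hw => ?_
  rw [Function.update_of_ne (Finset.ne_of_mem_erase hw)]

open Classical in
lemma nbrSign_update (G : SimpleGraph V) (v u : V) (x : V → Fin 2) (hx : x u = 0) :
    nbrSign G v (Function.update x u 1) = (if G.Adj v u then -1 else 1) * nbrSign G v x := by
  unfold nbrSign
  rw [prod_update_one (fun w a => if G.Adj v w then bitSign a else 1) u x hx (by simp)]
  simp

/-- Raising the bit of any vertex `v` from `0` to `1` multiplies the amplitude of `f` by `ζ v` and
by the neighbourhood sign of `v`. With `ζ = 1` this characterises graph states up to scalars. -/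
def HasFlips (G : SimpleGraph V) (ζ : V → ℂ) (f : QState V) : Prop :=
  ∀ v x, x v = 0 → f (Function.update x v 1) = ζ v * nbrSign G v x * f x

/-- Every bit string arises from 0 by raising bits one at a time, so the flip rule determines all
amplitudes from the one at 0. States are identified below by checking their flips. -/
lemma HasFlips.eq_smul {G : SimpleGraph V} {ζ : V → ℂ} {f g : QState V} (hf : HasFlips G ζ f)
    (hg : HasFlips G ζ g) (hg0 : g 0 ≠ 0) : f = (f 0 / g 0) • g := by
  have key : ∀ T : Finset V, f (fun v => if v ∈ T then 1 else 0) * g 0 =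
      f 0 * g (fun v => if v ∈ T then 1 else 0) := by
    intro T
    induction T using Finset.induction_on with
    | empty => simp only [Finset.notMem_empty, if_false]; rfl
    | insert v T hv ih =>
      have hup : (fun w => if w ∈ insert v T then (1 : Fin 2) else 0) =
          Function.update (fun w => if w ∈ T then (1 : Fin 2) else 0) v 1 := by
        funext w
        by_cases hw : w = v
        · subst hw; simp
        · simp [hw]
      rw [hup, hf v _ (by simp [hv]), hg v _ (by simp [hv]), mul_assoc, ih]
      ring
  funext x
  have hx : x = fun v => if v ∈ Finset.univ.filter (fun v => x v = 1) then 1 else 0 := by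
    funext v
    rcases fin_two_cases (x v) with h | h <;> simp [h]
  have := key (Finset.univ.filter fun v => x v = 1)
  rw [← hx] at this
  rw [Pi.smul_apply, smul_eq_mul, div_mul_eq_mul_div, ← this, mul_div_cancel_right₀ _ hg0]

open Classical in
lemma graphState_apply (G : SimpleGraph V) (x : V → Fin 2) :
    graphState G x = (∏ e ∈ G.edgeFinset, czDiag e x) * plusState V x := by
  simp only [graphState, Matrix.mulVec_diagonal, Finset.prod_apply]

lemma graphState_zero_ne (G : SimpleGraph V) : graphState G 0 ≠ 0 := by
  classical
  rw [graphState_apply]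
  refine mul_ne_zero (Finset.prod_ne_zero_iff.2 fun e _ => ?_) ?_
  · unfold czDiag
    split_ifs <;> simp
  · simp [plusState]

lemma graphState_ne_zero (G : SimpleGraph V) : graphState G ≠ 0 :=
  fun h => graphState_zero_ne G (by rw [h]; rfl)

/-- Raising the bit at v affects only the CZ gates on edges at v, and the edge to w then contributes
(-1)^(x w). This is the stabiliser X_v ∏ Z_w in terms of amplitudes. -/
lemma hasFlips_graphState (G : SimpleGraph V) : HasFlips G 1 (graphState G) := by
  classical
  intro v x hx
  have hnot : ∀ e : Sym2 V, v ∈ e → czDiag e x = 1 := by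
    intro e he
    unfold czDiag
    rw [if_neg]
    intro h
    rw [h v he] at hx
    exact one_ne_zero hx
  have hsplit : ∀ e : Sym2 V, czDiag e (Function.update x v 1) =
      (if v ∈ e then czDiag e (Function.update x v 1) else 1) * czDiag e x := by
    intro e
    by_cases he : v ∈ e
    · rw [if_pos he, hnot e he, mul_one]
    · rw [if_neg he, one_mul]
      unfold czDiag
      congr 1
      refine propext (forall₂_congr fun w hw => ?_)
      rw [Function.update_of_ne (by rintro rfl; exact he hw)]
  have hinc : G.edgeFinset.filter (fun e => v ∈ e) =
      (Finset.univ.filter fun w => G.Adj v w).image fun w => s(v, w) := by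
    ext e
    induction e using Sym2.ind with
    | _ a b =>
      simp only [Finset.mem_filter, SimpleGraph.mem_edgeFinset, SimpleGraph.mem_edgeSet,
        Sym2.mem_iff, Finset.mem_image, Finset.mem_univ, true_and, Sym2.eq_iff]
      constructor
      · rintro ⟨h, rfl | rfl⟩
        · exact ⟨b, h, Or.inl ⟨rfl, rfl⟩⟩
        · exact ⟨a, h.symm, Or.inr ⟨rfl, rfl⟩⟩
      · rintro ⟨w, h, ⟨rfl, rfl⟩ | ⟨rfl, rfl⟩⟩
        · exact ⟨h, Or.inl rfl⟩
        · exact ⟨h.symm, Or.inr rfl⟩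
  have hprod : ∏ e ∈ G.edgeFinset, czDiag e (Function.update x v 1) =
      nbrSign G v x * ∏ e ∈ G.edgeFinset, czDiag e x := by
    rw [Finset.prod_congr rfl fun e _ => hsplit e, Finset.prod_mul_distrib, ← Finset.prod_filter,
      hinc, Finset.prod_image (fun w _ w' _ h => Sym2.congr_right.1 h), Finset.prod_filter, nbrSign]
    congr 1
    refine Finset.prod_congr rfl fun w _ => ?_
    by_cases hw : G.Adj v w
    · rw [if_pos hw, if_pos hw]
      have hne : w ≠ v := hw.ne'
      unfold czDiag
      rcases fin_two_cases (x w) with h | h <;> simp [h, Function.update_of_ne hne]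
    · rw [if_neg hw, if_neg hw]
  rw [graphState_apply, graphState_apply, hprod, Pi.one_apply, one_mul, mul_assoc]
  rfl

lemma localOp_diagonal_mulVec (d : V → Fin 2 → ℂ) (ψ : QState V) (x : V → Fin 2) :
    (localOp fun v => Matrix.diagonal (d v)).mulVec ψ x = (∏ v, d v (x v)) * ψ x := by
  rw [Matrix.mulVec, dotProduct, Finset.sum_eq_single x]
  · simp [localOp]
  · intro y _ hy
    obtain ⟨v, hv⟩ := Function.ne_iff.1 hy
    have : localOp (fun v => Matrix.diagonal (d v)) x y = 0 :=
      Finset.prod_eq_zero (Finset.mem_univ v) (Matrix.diagonal_apply_ne _ hv.symm)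
    rw [this, zero_mul]
  · simp

lemma localOp_update_mulVec (v : V) (M : Op1) (ψ : QState V) (x : V → Fin 2) :
    (localOp (Function.update (fun _ => 1) v M)).mulVec ψ x =
      ∑ a, M (x v) a * ψ (Function.update x v a) := by
  have hentry : ∀ y, localOp (Function.update (fun _ => 1) v M) x y =
      ∑ a, if y = Function.update x v a then M (x v) a else 0 := by
    intro y
    have hL : localOp (Function.update (fun _ => 1) v M) x y =
        M (x v) (y v) * ∏ w ∈ Finset.univ.erase v, (1 : Op1) (x w) (y w) := by
      rw [localOp, Matrix.of_apply, ← Finset.mul_prod_erase Finset.univ _ (Finset.mem_univ v),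
        Function.update_self]
      congr 1
      refine Finset.prod_congr rfl fun w hw => ?_
      rw [Function.update_of_ne (Finset.ne_of_mem_erase hw)]
    rw [hL]
    by_cases h : ∀ w, w ≠ v → y w = x w
    · have hy : ∀ a, y = Function.update x v a ↔ y v = a := by
        intro a
        rw [Function.eq_update_iff]
        exact ⟨fun h' => h'.1, fun h' => ⟨h', h⟩⟩
      rw [Finset.prod_eq_one fun w hw => by
        rw [h w (Finset.ne_of_mem_erase hw), Matrix.one_apply_eq]]
      simp [hy]
    · push Not at h
      obtain ⟨w, hwv, hw⟩ := h
      have h0 : ∏ w ∈ Finset.univ.erase v, (1 : Op1) (x w) (y w) = 0 :=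
        Finset.prod_eq_zero (Finset.mem_erase.2 ⟨hwv, Finset.mem_univ w⟩)
          (Matrix.one_apply_ne hw.symm)
      rw [h0, mul_zero]
      refine (Finset.sum_eq_zero fun a _ => if_neg ?_).symm
      rintro rfl
      exact hw (Function.update_of_ne hwv _ _)
  simp only [Matrix.mulVec, dotProduct, hentry, Finset.sum_mul]
  rw [Finset.sum_comm]
  simp

/-- A state with the flips of a graph up to signs is that graph state up to gates `Z`. -/
lemma HasFlips.lcEquiv {G : SimpleGraph V} {ζ : V → ℂ} {f : QState V} (hf : HasFlips G ζ f)
    (hζ : ∀ v, ζ v = 1 ∨ ζ v = -1) (hf0 : f 0 ≠ 0) : LCEquiv f (graphState G) := by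
  -- The gate diag(1, ζ v) is 1 or Z and inserts the missing factor ζ v into the flips of the graph
  -- state.
  set d : V → Fin 2 → ℂ := fun v a => if a = 1 then ζ v else 1 with hd
  have hg : HasFlips G ζ ((localOp fun v => Matrix.diagonal (d v)).mulVec (graphState G)) := by
    intro v x hx
    rw [localOp_diagonal_mulVec, localOp_diagonal_mulVec, hasFlips_graphState G v x hx,
      prod_update_one d v x hx (by simp [hd])]
    simp only [hd, Pi.one_apply, if_true]
    ring
  have hg0 : (localOp fun v => Matrix.diagonal (d v)).mulVec (graphState G) 0 ≠ 0 := by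
    rw [localOp_diagonal_mulVec]
    simpa [hd] using graphState_zero_ne G
  refine ⟨_, fun v => ?_, _, div_ne_zero hf0 hg0, hf.eq_smul hg hg0⟩
  rcases hζ v with h | h
  · have : Matrix.diagonal (d v) = (1 : Op1) := by
      rw [← Matrix.diagonal_one]
      congr 1
      funext a
      simp [hd, h]
    exact this ▸ isClifford_one
  · have : Matrix.diagonal (d v) = pauliZ := by
      ext i j
      fin_cases i <;> fin_cases j <;> simp [hd, h, pauliZ]
    exact this ▸ isClifford_pauliZ

/-! ### Local complementation -/

/-- The local complement of `G` at `v`: the edges between neighbours of `v` are toggled. -/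
def localComplement (G : SimpleGraph V) (v : V) : SimpleGraph V where
  Adj u w := u ≠ w ∧ ¬ (G.Adj u w ↔ G.Adj v u ∧ G.Adj v w)
  symm := ⟨fun u w h => ⟨h.1.symm, by rw [G.adj_comm w u, and_comm]; exact h.2⟩⟩
  loopless := ⟨fun u h => h.1 rfl⟩

lemma localComplement_adj_of_not_adj {V : Type*} (G : SimpleGraph V) {v u : V} (h : ¬ G.Adj v u) (w : V) :
    (localComplement G v).Adj u w ↔ G.Adj u w := by
  simp only [localComplement, h, false_and, iff_false, not_not]
  exact ⟨fun h => h.2, fun h => ⟨h.ne, h⟩⟩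

open Classical in
/-- The local Clifford gates that realise the local complementation at `v`. -/
noncomputable def complementGate (G : SimpleGraph V) (v w : V) : Op1 :=
  if w = v then sqrtXGate else if G.Adj v w then phaseGate else 1

lemma isClifford_complementGate {V : Type*} [DecidableEq V] (G : SimpleGraph V) (v w : V) :
    IsClifford (complementGate G v w) := by
  unfold complementGate
  split_ifs
  exacts [isClifford_sqrtXGate, isClifford_phaseGate, isClifford_one]

-- On a graph state X_v acts as the neighbourhood sign n, so the gate at v, which is ((1 - i) + (1 +
-- i)X)/2, acts as multiplication by 1 if n = 1 and by -i if n = -1. The phase gates supply the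
-- product of powers of i.
open Classical in
lemma localOp_complementGate_mulVec (G : SimpleGraph V) (v : V) (x : V → Fin 2) :
    (localOp (complementGate G v)).mulVec (graphState G) x =
      (∏ w, if G.Adj v w then Complex.I ^ (x w : ℕ) else 1) *
        ((1 - Complex.I + (1 + Complex.I) * nbrSign G v x) / 2) * graphState G x := by
  have hfac : complementGate G v = fun w =>
      Matrix.diagonal (fun a : Fin 2 => if G.Adj v w then Complex.I ^ (a : ℕ) else 1) *
        Function.update (fun _ => (1 : Op1)) v sqrtXGate w := by
    funext w
    unfold complementGate
    by_cases hw : w = v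
    · subst hw
      simp
    · rw [if_neg hw, Function.update_of_ne hw, mul_one]
      split_ifs
      · ext i j
        fin_cases i <;> fin_cases j <;> simp [phaseGate]
      · simp
  rw [hfac, ← localOp_mul, ← Matrix.mulVec_mulVec, localOp_diagonal_mulVec, localOp_update_mulVec,
    mul_assoc]
  congr 1
  have hself : ∀ a, x v = a → Function.update x v a = x := by
    rintro a rfl; exact Function.update_eq_self v x
  rcases fin_two_cases (x v) with h | h
  · have h1 := hasFlips_graphState G v x h
    simp [h, Fin.sum_univ_two, hself 0 h, h1, sqrtXGate]
    ring
  -- The flip rule starts from a zero bit, so it is used at x with the bit at v lowered; the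
  -- neighbourhood sign of v does not see that bit.
  · have h1 := hasFlips_graphState G v (Function.update x v 0) (by simp)
    rw [Function.update_idem, hself 1 h] at h1
    have h2 := nbrSign_update G v v (Function.update x v 0) (by simp)
    rw [Function.update_idem, hself 1 h, if_neg (G.loopless.irrefl v), one_mul] at h2
    rw [← h2, Pi.one_apply, one_mul] at h1
    simp [h, Fin.sum_univ_two, hself 1 h, sqrtXGate]
    rcases nbrSign_eq G v x with hn | hn <;> rw [hn] at h1 ⊢ <;> rw [h1] <;> ring

lemma nbrSign_localComplement_of_not_adj {V : Type*} [Fintype V] (G : SimpleGraph V) {v u : V} (h : ¬ G.Adj v u)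
    (x : V → Fin 2) : nbrSign (localComplement G v) u x = nbrSign G u x := by
  classical
  unfold nbrSign
  refine Finset.prod_congr rfl fun w _ => ?_
  simp only [localComplement_adj_of_not_adj G h]

lemma nbrSign_localComplement_of_adj (G : SimpleGraph V) {v u : V} (h : G.Adj v u)
    (x : V → Fin 2) (hx : x u = 0) :
    nbrSign (localComplement G v) u x = nbrSign G u x * nbrSign G v x := by
  classical
  simp only [nbrSign, ← Finset.prod_mul_distrib]
  refine Finset.prod_congr rfl fun w _ => ?_
  by_cases hw : u = w
  · subst hw; simp [hx]
  · by_cases h1 : G.Adj u w <;> by_cases h2 : G.Adj v w <;>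
      rcases fin_two_cases (x w) with h3 | h3 <;>
      simp [localComplement, h, hw, h1, h2, h3]

/-- If k neighbours of v carry the bit 1, the gates multiply the amplitude by i^k, times -i when k
is odd. This is (-1)^(k choose 2): one sign for each pair of excited neighbours, that is, CZ on all
pairs of neighbours. -/
lemma exists_graphState_localComplement (G : SimpleGraph V) (v : V) :
    ∃ c : ℂ, c ≠ 0 ∧ graphState (localComplement G v) =
      c • (localOp (complementGate G v)).mulVec (graphState G) := by
  classical
  have hf : HasFlips (localComplement G v) 1
      ((localOp (complementGate G v)).mulVec (graphState G)) := by
    intro u x hx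
    rw [localOp_complementGate_mulVec, localOp_complementGate_mulVec, nbrSign_update G v u x hx,
      hasFlips_graphState G u x hx, prod_update_one
        (fun w a => if G.Adj v w then Complex.I ^ (a : ℕ) else 1) u x hx (by simp)]
    simp only [Pi.one_apply, one_mul]
    by_cases h : G.Adj v u
    · rw [nbrSign_localComplement_of_adj G h x hx, if_pos h, if_pos h]
      have hI := Complex.I_mul_I
      rcases nbrSign_eq G v x with hn | hn <;> rw [hn] <;> simp only [Fin.val_one, pow_one]
      · linear_combination (-(∏ w, if G.Adj v w then Complex.I ^ (x w : ℕ) else 1) *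
          nbrSign G u x * graphState G x) * hI
      · ring
    · rw [nbrSign_localComplement_of_not_adj G h, if_neg h, if_neg h]
      ring
  have hf0 : (localOp (complementGate G v)).mulVec (graphState G) 0 ≠ 0 := by
    rw [localOp_complementGate_mulVec, nbrSign_zero]
    simpa using graphState_zero_ne G
  exact ⟨_, div_ne_zero (graphState_zero_ne _) hf0,
    (hasFlips_graphState _).eq_smul hf hf0⟩

lemma lcEquiv_localComplement (G : SimpleGraph V) (v : V) :
    LCEquiv (graphState (localComplement G v)) (graphState G) := by
  obtain ⟨c, hc, h⟩ := exists_graphState_localComplement G v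
  exact ⟨_, isClifford_complementGate G v, c, hc, h⟩

end GraphStates

end GraphFusion

namespace GraphFusion

/-! ### Contracting two qubits of a state -/

section Fuse

variable {V : Type*} [DecidableEq V] {A B : V}

/-- The bit string with the values `a` at `A`, `b` at `B` and `y` elsewhere. -/
def glue (A B : V) (a b : Fin 2) (y : Rest A B → Fin 2) : V → Fin 2 := fun v =>
  if hA : v = A then a else if hB : v = B then b else y ⟨v, hA, hB⟩

@[simp] lemma glue_left (a b : Fin 2) (y : Rest A B → Fin 2) : glue A B a b y A = a := by
  simp [glue]

lemma glue_right (hAB : A ≠ B) (a b : Fin 2) (y : Rest A B → Fin 2) :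
    glue A B a b y B = b := by
  simp [glue, hAB.symm]

@[simp] lemma glue_rest (a b : Fin 2) (y : Rest A B → Fin 2) (v : Rest A B) :
    glue A B a b y v.1 = y v := by
  simp [glue, v.2.1, v.2.2]

lemma eq_of_eq_on_parts {α : Type*} {f g : V → α} (hA : f A = g A) (hB : f B = g B)
    (h : ∀ v : Rest A B, f v = g v) : f = g := by
  funext v
  by_cases hvA : v = A
  · rw [hvA, hA]
  by_cases hvB : v = B
  · rw [hvB, hB]
  exact h ⟨v, hvA, hvB⟩

lemma glue_eta (hAB : A ≠ B) (x : V → Fin 2) :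
    glue A B (x A) (x B) (fun v => x v.1) = x :=
  eq_of_eq_on_parts (A := A) (B := B) (glue_left _ _ _) (glue_right hAB _ _ _)
    fun v => glue_rest _ _ _ v

/-- Bit strings split into the bits at `A` and `B` and the remaining ones. -/
def glueEquiv (hAB : A ≠ B) : (Fin 2 × Fin 2) × (Rest A B → Fin 2) ≃ (V → Fin 2) where
  toFun p := glue A B p.1.1 p.1.2 p.2
  invFun x := ((x A, x B), fun v => x v.1)
  left_inv p := by
    obtain ⟨⟨a, b⟩, y⟩ := p
    simp [glue_right hAB]
  right_inv x := glue_eta hAB x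

lemma update_glue_left (b : Fin 2) (y : Rest A B → Fin 2) :
    Function.update (glue A B 0 b y) A 1 = glue A B 1 b y := by
  funext v
  by_cases hA : v = A
  · subst hA; simp
  · simp [glue, hA]

lemma update_glue_right (hAB : A ≠ B) (a : Fin 2) (y : Rest A B → Fin 2) :
    Function.update (glue A B a 0 y) B 1 = glue A B a 1 y := by
  funext v
  by_cases hB : v = B
  · subst hB; simp [glue_right hAB]
  · simp [glue, hB]

lemma update_glue_rest (hAB : A ≠ B) (a b : Fin 2) (y : Rest A B → Fin 2) (u : Rest A B) :
    Function.update (glue A B a b y) u.1 1 = glue A B a b (Function.update y u 1) := by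
  refine eq_of_eq_on_parts (A := A) (B := B) ?_ ?_ fun v => ?_
  · rw [Function.update_of_ne u.2.1.symm, glue_left, glue_left]
  · rw [Function.update_of_ne u.2.2.symm, glue_right hAB, glue_right hAB]
  · rw [glue_rest]
    by_cases h : v = u
    · subst h; simp
    · rw [Function.update_of_ne h, Function.update_of_ne (fun h' => h (Subtype.ext h')), glue_rest]

/-- The state of the remaining qubits after contracting the qubits `A, B` of `ψ` with the
(not conjugated) amplitudes `K`. -/
noncomputable def fuse (A B : V) (K : Op1) (ψ : QState V) : QState (Rest A B) := fun y =>
  ∑ a, ∑ b, K a b * ψ (glue A B a b y)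

lemma fuse_smul (K : Op1) (c : ℂ) (ψ : QState V) : fuse A B K (c • ψ) = c • fuse A B K ψ := by
  funext y
  simp only [fuse, Pi.smul_apply, smul_eq_mul, Finset.mul_sum]
  exact Finset.sum_congr rfl fun a _ => Finset.sum_congr rfl fun b _ => by ring

lemma smul_fuse (K : Op1) (c : ℂ) (ψ : QState V) : fuse A B (c • K) ψ = c • fuse A B K ψ := by
  funext y
  simp only [fuse, Matrix.smul_apply, Pi.smul_apply, smul_eq_mul, Finset.mul_sum]
  exact Finset.sum_congr rfl fun a _ => Finset.sum_congr rfl fun b _ => by ring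

variable [Fintype V]

lemma sum_glue (hAB : A ≠ B) (F : (V → Fin 2) → ℂ) :
    ∑ x, F x = ∑ a, ∑ b, ∑ y, F (glue A B a b y) := by
  rw [← (glueEquiv hAB).sum_comp, Fintype.sum_prod_type, Fintype.sum_prod_type]
  rfl

lemma prod_rest (hAB : A ≠ B) (F : V → ℂ) : ∏ v, F v = F A * F B * ∏ v : Rest A B, F v := by
  rw [← Finset.mul_prod_erase Finset.univ _ (Finset.mem_univ A),
    ← Finset.mul_prod_erase (Finset.univ.erase A) _
      (Finset.mem_erase.2 ⟨hAB.symm, Finset.mem_univ B⟩), mul_assoc]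
  congr 2
  exact Finset.prod_subtype _ (fun v => by simp [and_comm]) F

/-- Gates on A and B can be moved into the contraction coefficients; since K is not conjugated, the
gate at A enters transposed. -/
lemma fuse_localOp (hAB : A ≠ B) (K : Op1) (U : V → Op1) (ψ : QState V) :
    fuse A B K ((localOp U).mulVec ψ) =
      (localOp fun v : Rest A B => U v).mulVec
        (fuse A B ((U A).transpose * K * U B) ψ) := by
  funext y
  have hentry : ∀ a b a' b' y', localOp U (glue A B a b y) (glue A B a' b' y') =
      U A a a' * U B b b' * localOp (fun v : Rest A B => U v) y y' := by
    intro a b a' b' y'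
    simp only [localOp, Matrix.of_apply]
    rw [prod_rest hAB]
    simp only [glue_left, glue_right hAB, glue_rest]
  have hL : ∀ a b, (localOp U).mulVec ψ (glue A B a b y) =
      ∑ y', localOp (fun v : Rest A B => U v) y y' *
        ∑ a', ∑ b', U A a a' * U B b b' * ψ (glue A B a' b' y') := by
    intro a b
    rw [Matrix.mulVec, dotProduct, sum_glue hAB]
    simp only [hentry, Fin.sum_univ_two, ← Finset.sum_add_distrib]
    exact Finset.sum_congr rfl fun y' _ => by ring
  rw [fuse]
  simp only [hL]
  simp only [fuse, Matrix.mulVec, dotProduct, Finset.mul_sum, Fin.sum_univ_two,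
    Matrix.mul_apply, Matrix.transpose_apply, ← Finset.sum_add_distrib]
  exact Finset.sum_congr rfl fun y' _ => by ring

/-! ### Contracting two qubits of a graph state -/

open Classical in
/-- The sign `∏ (-1)^{y w}` over the neighbours `w` of `v` among the remaining qubits. -/
noncomputable def crossSign (G : SimpleGraph V) (v : V) (y : Rest A B → Fin 2) : ℂ :=
  ∏ w : Rest A B, if G.Adj v w then bitSign (y w) else 1

lemma crossSign_eq (G : SimpleGraph V) (v : V) (y : Rest A B → Fin 2) :
    crossSign G v y = 1 ∨ crossSign G v y = -1 := by
  classical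
  unfold crossSign
  refine Finset.prod_induction _ (fun c : ℂ => c = 1 ∨ c = -1) ?_ (Or.inl rfl) ?_
  · rintro a b (rfl | rfl) (rfl | rfl) <;> simp
  · intro w _
    split_ifs
    · exact bitSign_eq _
    · exact Or.inl rfl

@[simp] lemma crossSign_zero (G : SimpleGraph V) (v : V) :
    crossSign G v (0 : Rest A B → Fin 2) = 1 := by
  simp [crossSign]

open Classical in
lemma crossSign_update (G : SimpleGraph V) (v : V) (u : Rest A B) (y : Rest A B → Fin 2)
    (hy : y u = 0) :
    crossSign G v (Function.update y u 1) = (if G.Adj v u then -1 else 1) * crossSign G v y := by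
  unfold crossSign
  rw [prod_update_one (fun w : Rest A B => fun a => if G.Adj v w then bitSign a else 1) u y hy
    (by simp)]
  simp

open Classical in
lemma nbrSign_glue (hAB : A ≠ B) (G : SimpleGraph V) (v : V) (a b : Fin 2)
    (y : Rest A B → Fin 2) :
    nbrSign G v (glue A B a b y) = (if G.Adj v A then bitSign a else 1) *
      (if G.Adj v B then bitSign b else 1) * crossSign G v y := by
  unfold nbrSign crossSign
  rw [prod_rest hAB]
  simp only [glue_left, glue_right hAB, glue_rest]

/-- The graph induced on the remaining qubits. -/
abbrev restGraph {V : Type*} (A B : V) (G : SimpleGraph V) : SimpleGraph (Rest A B) :=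
  G.comap Subtype.val

open Classical in
lemma exists_graphState_glue (hAB : A ≠ B) (G : SimpleGraph V) :
    ∃ c : ℂ, c ≠ 0 ∧ ∀ a b y, graphState G (glue A B a b y) =
      c * (if G.Adj A B then bitSign (a * b) else 1) * crossSign G A y ^ (a : ℕ) *
        crossSign G B y ^ (b : ℕ) * graphState (restGraph A B G) y := by
  -- With the bits at A and B zero, neither affects the flips of the other qubits, so this slice is
  -- the induced graph state up to a scalar.
  have hflips : HasFlips (restGraph A B G) 1 fun y => graphState G (glue A B 0 0 y) := by
    intro u y hy
    simp only
    rw [← update_glue_rest hAB, hasFlips_graphState G _ _ (by simpa using hy), nbrSign_glue hAB]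
    simp [crossSign, nbrSign]
  have h := hflips.eq_smul (hasFlips_graphState _) (graphState_zero_ne _)
  refine ⟨graphState G (glue A B 0 0 0) / _, div_ne_zero ?_ (graphState_zero_ne (restGraph A B G)), fun a b y => ?_⟩
  · have : glue A B 0 0 0 = 0 := eq_of_eq_on_parts (A := A) (B := B) (by simp)
      (by simp [glue_right hAB]) (by simp)
    rw [this]
    exact graphState_zero_ne G
  have h00 := congrFun h y
  have hB : ∀ a, graphState G (glue A B a 1 y) = (if G.Adj B A then bitSign a else 1) *
      crossSign G B y * graphState G (glue A B a 0 y) := by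
    intro a
    rw [← update_glue_right hAB, hasFlips_graphState G _ _ (glue_right hAB _ _ _),
      nbrSign_glue hAB]
    simp
  have hA : graphState G (glue A B 1 0 y) =
      crossSign G A y * graphState G (glue A B 0 0 y) := by
    rw [← update_glue_left, hasFlips_graphState G _ _ (glue_left _ _ _), nbrSign_glue hAB]
    simp
  simp only [Pi.smul_apply, smul_eq_mul] at h00
  rcases fin_two_cases a with rfl | rfl <;> rcases fin_two_cases b with rfl | rfl <;>
    simp [hA, hB, h00, G.adj_comm B A] <;> ring_nf

lemma exists_fuse_graphState (hAB : A ≠ B) (G : SimpleGraph V) (h : ¬ G.Adj A B) :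
    ∃ c : ℂ, c ≠ 0 ∧ ∀ K y, fuse A B K (graphState G) y =
      c * (K 0 0 + K 0 1 * crossSign G B y + K 1 0 * crossSign G A y +
        K 1 1 * (crossSign G A y * crossSign G B y)) * graphState (restGraph A B G) y := by
  obtain ⟨c, hc, hG⟩ := exists_graphState_glue hAB G
  refine ⟨c, hc, fun K y => ?_⟩
  simp only [fuse, hG, Fin.sum_univ_two, if_neg h, Fin.val_zero, Fin.val_one, pow_zero, pow_one]
  ring

/-- The graph on the remaining qubits after the fusion of two nonadjacent qubits: the edges
between a neighbour of `A` and a neighbour of `B` are toggled. -/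
def fusedGraph {V : Type*} (A B : V) (G : SimpleGraph V) : SimpleGraph (Rest A B) where
  Adj u w := u ≠ w ∧
    ¬ (G.Adj u w ↔ ¬ ((G.Adj A u ∧ G.Adj B w) ↔ (G.Adj A w ∧ G.Adj B u)))
  symm := ⟨fun u w h => ⟨h.1.symm, by
    rw [G.adj_comm w u, @iff_comm (G.Adj A w ∧ G.Adj B u)]; exact h.2⟩⟩
  loopless := ⟨fun u h => h.1 rfl⟩

-- The new neighbourhood of u is the old one, with N(B) toggled if u is in N(A) and N(A) toggled if
-- u is in N(B). A loop at u that this might create is harmless because y u = 0.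
open Classical in
lemma nbrSign_fusedGraph (G : SimpleGraph V) (u : Rest A B) (y : Rest A B → Fin 2)
    (hy : y u = 0) :
    nbrSign (fusedGraph A B G) u y = (if G.Adj A u then crossSign G B y else 1) *
      (if G.Adj B u then crossSign G A y else 1) * nbrSign (restGraph A B G) u y := by
  have h1 : ∀ v v' : V, (if G.Adj v u then crossSign G v' y else 1) =
      ∏ w : Rest A B, if G.Adj v u then (if G.Adj v' w then bitSign (y w) else 1) else 1 := by
    intro v v'
    unfold crossSign
    split_ifs <;> simp
  rw [h1, h1]
  simp only [nbrSign, ← Finset.prod_mul_distrib]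
  refine Finset.prod_congr rfl fun w _ => ?_
  by_cases hw : u = w
  · subst hw; simp [hy]
  · by_cases hA : G.Adj A u <;> by_cases hB : G.Adj B u <;> by_cases hA' : G.Adj A w <;>
      by_cases hB' : G.Adj B w <;> by_cases hG : G.Adj u w <;>
      rcases fin_two_cases (y w) with h3 | h3 <;>
      simp [fusedGraph, hw, hA, hB, hA', hB', hG, h3]

/-- The amplitudes of the joint eigenvectors of `X ⊗ Z` and `Z ⊗ X`. -/
def bellCoeff (s t : ℂ) : Op1 := !![1, t; s, -(s * t)]

/-- With p = s·χ_A and q = t·χ_B, where χ are the cross signs, the contraction factor is 1 + p + q -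
pq. It equals -2 if p = q = -1 and 2 otherwise: a CZ between the parities over N(A) and N(B), which
toggles the edges between them. The outcomes s, t only enter the Z corrections ζ. -/
lemma lcEquiv_fuse_bellCoeff (hAB : A ≠ B) (G : SimpleGraph V) (h : ¬ G.Adj A B) {s t : ℂ}
    (hs : s = 1 ∨ s = -1) (ht : t = 1 ∨ t = -1) :
    LCEquiv (fuse A B (bellCoeff s t) (graphState G)) (graphState (fusedGraph A B G)) := by
  classical
  obtain ⟨c, hc, hf⟩ := exists_fuse_graphState hAB G h
  refine HasFlips.lcEquiv (ζ := fun u : Rest A B => (if G.Adj A u then t else 1) *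
    (if G.Adj B u then s else 1) * (if G.Adj A u ∧ G.Adj B u then -1 else 1)) ?_ ?_ ?_
  · intro u y hy
    rw [hf, hf, hasFlips_graphState _ u y hy, crossSign_update G A u y hy,
      crossSign_update G B u y hy, nbrSign_fusedGraph G u y hy]
    rcases crossSign_eq G A y with h1 | h1 <;> rcases crossSign_eq G B y with h2 | h2 <;>
      rcases hs with rfl | rfl <;> rcases ht with rfl | rfl <;>
      by_cases hA : G.Adj A u <;> by_cases hB : G.Adj B u <;>
      simp [bellCoeff, h1, h2, hA, hB] <;> ring
  · intro u
    split_ifs <;> rcases hs with rfl | rfl <;> rcases ht with rfl | rfl <;> simp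
  · rw [hf]
    refine mul_ne_zero (mul_ne_zero hc ?_) (graphState_zero_ne _)
    rcases hs with rfl | rfl <;> rcases ht with rfl | rfl <;> norm_num [bellCoeff]

/-- When N(A) = N(B), every pair of vertices in it is toggled twice. -/
lemma fusedGraph_of_twins {V : Type*} {A B : V} (G : SimpleGraph V) (h : ∀ w, G.Adj A w ↔ G.Adj B w) :
    fusedGraph A B G = restGraph A B G := by
  ext u w
  simp only [fusedGraph, SimpleGraph.comap_adj, h, and_comm, iff_self, not_true_eq_false,
    iff_false, not_not]
  exact ⟨fun h => h.1, fun h => ⟨h, fun h' => h.ne (congrArg _ h')⟩⟩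

/-- Contracting nonadjacent twins with coefficients that are supported either on the diagonal or
off the diagonal. -/
lemma lcEquiv_fuse_of_twins (hAB : A ≠ B) (G : SimpleGraph V) (h : ¬ G.Adj A B)
    (htw : ∀ w, G.Adj A w ↔ G.Adj B w) {K : Op1}
    (hK : (K 0 0 = 0 ∧ K 1 1 = 0) ∨ (K 0 1 = 0 ∧ K 1 0 = 0))
    (h0 : fuse A B K (graphState G) ≠ 0) :
    LCEquiv (fuse A B K (graphState G)) (graphState (restGraph A B G)) := by
  classical
  obtain ⟨c, hc, hf⟩ := exists_fuse_graphState hAB G h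
  have hcross : ∀ y : Rest A B → Fin 2, crossSign G B y = crossSign G A y := fun y => by
    simp only [crossSign, htw]
  rcases hK with ⟨h1, h2⟩ | ⟨h1, h2⟩
  · have hform : ∀ y, fuse A B K (graphState G) y =
        c * (K 0 1 + K 1 0) * crossSign G A y * graphState (restGraph A B G) y := by
      intro y
      rw [hf, hcross, h1, h2]
      ring
    have hne : K 0 1 + K 1 0 ≠ 0 := fun h' => h0 (by funext y; rw [hform, h']; simp)
    refine HasFlips.lcEquiv (ζ := fun u : Rest A B => if G.Adj A u then -1 else 1) ?_ ?_ ?_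
    · intro u y hy
      rw [hform, hform, hasFlips_graphState _ u y hy, crossSign_update G A u y hy, Pi.one_apply]
      ring
    · intro u
      split_ifs <;> simp
    · rw [hform]
      exact mul_ne_zero (mul_ne_zero (mul_ne_zero hc hne) (by simp)) (graphState_zero_ne _)
  · have hform : fuse A B K (graphState G) =
        (c * (K 0 0 + K 1 1)) • graphState (restGraph A B G) := by
      funext y
      rw [hf, hcross, h1, h2, Pi.smul_apply, smul_eq_mul]
      rcases crossSign_eq G A y with h | h <;> rw [h] <;> ring
    refine .of_smul (fun h' => h0 ?_) hform
    rw [hform, h', zero_smul]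

/-- If `A` and `B` have no neighbours outside `{A, B}`, every contraction yields the state of the
induced graph. -/
lemma exists_fuse_eq_smul_of_isolated (hAB : A ≠ B) (G : SimpleGraph V)
    (hA : ∀ w : Rest A B, ¬ G.Adj A w) (hB : ∀ w : Rest A B, ¬ G.Adj B w) (K : Op1) :
    ∃ c : ℂ, fuse A B K (graphState G) = c • graphState (restGraph A B G) := by
  classical
  obtain ⟨c, -, hG⟩ := exists_graphState_glue hAB G
  have h1 : ∀ y : Rest A B → Fin 2, crossSign G A y = 1 := by simp [crossSign, hA]
  have h2 : ∀ y : Rest A B → Fin 2, crossSign G B y = 1 := by simp [crossSign, hB]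
  -- Both cross signs are trivial, so the bits at A and B only enter this scalar.
  refine ⟨∑ a, ∑ b, K a b * (c * if G.Adj A B then bitSign (a * b) else 1), ?_⟩
  funext y
  simp only [fuse, hG, h1, h2, one_pow, mul_one, Pi.smul_apply, smul_eq_mul, Finset.sum_mul,
    mul_assoc]

/-- The four coefficient matrices sum to four times the matrix unit at (0, 0). If all contractions
vanished, so would the nonzero amplitude at the zero string. -/
lemma exists_fuse_bellCoeff_ne_zero (hAB : A ≠ B) (G : SimpleGraph V) :
    ∃ s t : ℤˣ, fuse A B (bellCoeff (s : ℤ) (t : ℤ)) (graphState G) ≠ 0 := by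
  by_contra! hall
  have key : ∀ s t : ℤˣ, _ := fun s t => congrFun (hall s t) 0
  refine graphState_zero_ne G ?_
  have h0 : graphState G (glue A B 0 0 0) = 0 := by
    have h1 := key 1 1
    have h2 := key 1 (-1)
    have h3 := key (-1) 1
    have h4 := key (-1) (-1)
    simp [fuse, Fin.sum_univ_two, bellCoeff] at h1 h2 h3 h4
    linear_combination (h1 + h2 + h3 + h4) / 4
  rwa [show glue A B 0 0 0 = 0 from eq_of_eq_on_parts (A := A) (B := B) (by simp)
    (by simp [glue_right hAB]) (by simp)] at h0

end Fuse

end GraphFusion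

namespace GraphFusion

/-! ### The action of Clifford gates on Pauli relations -/

/-- `K` is, up to scalars, fixed by the Pauli operators `a` and `b` on its two sides. -/
def PauliRel (K : Op1) (a b : Fin 2 × Fin 2) : Prop :=
  ∃ c : ℂ, c ≠ 0 ∧ pauliOp a * K * pauliOp b = c • K

lemma PauliRel.add {K : Op1} {a b a' b' : Fin 2 × Fin 2} (h : PauliRel K a b)
    (h' : PauliRel K a' b') : PauliRel K (a + a') (b + b') := by
  obtain ⟨c, hc, h⟩ := h
  obtain ⟨c', hc', h'⟩ := h'
  obtain ⟨j, hj⟩ := pauliOp_mul a a'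
  obtain ⟨k, hk⟩ := pauliOp_mul b' b
  have hI : ∀ n : ℕ, Complex.I ^ n ≠ 0 := fun n => pow_ne_zero n Complex.I_ne_zero
  refine ⟨(Complex.I ^ j * Complex.I ^ k)⁻¹ * (c * c'),
    mul_ne_zero (inv_ne_zero (mul_ne_zero (hI j) (hI k))) (mul_ne_zero hc hc'), ?_⟩
  have key : (Complex.I ^ j * Complex.I ^ k) • (pauliOp (a + a') * K * pauliOp (b + b')) =
      (c * c') • K := by
    calc _ = (Complex.I ^ j • pauliOp (a + a')) * K * (Complex.I ^ k • pauliOp (b' + b)) := by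
          rw [Matrix.smul_mul, smul_mul_smul_comm, add_comm b' b]
      _ = pauliOp a * (pauliOp a' * K * pauliOp b') * pauliOp b := by
          rw [← hj, ← hk]; simp only [mul_assoc]
      _ = _ := by
          rw [h', Matrix.mul_smul, Matrix.smul_mul, h, smul_smul, mul_comm]
  rw [← smul_smul, ← key, smul_smul, inv_mul_cancel₀ (mul_ne_zero (hI j) (hI k)), one_smul]

/-- The action of the square root of `X` on Pauli letters. -/
def sqrtXLetter (l : Fin 2 × Fin 2) : Fin 2 × Fin 2 := (l.1 + l.2, l.2)

/-- The action of the phase gate on Pauli letters. -/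
def phaseLetter (l : Fin 2 × Fin 2) : Fin 2 × Fin 2 := (l.1, l.2 + l.1)

/-- `g` describes the action of the gate `U` on Pauli letters. -/
def ActsOnLetters (U : Op1) (g : Fin 2 × Fin 2 → Fin 2 × Fin 2) : Prop :=
  ∀ l, (∃ c : ℂ, c ≠ 0 ∧ pauliOp (g l) * U.map star = c • (U.map star * pauliOp l)) ∧
    ∃ c : ℂ, c ≠ 0 ∧ star U * pauliOp (g l) = c • (pauliOp l * star U)

lemma actsOnLetters_one : ActsOnLetters 1 id := fun l =>
  ⟨⟨1, one_ne_zero, by simp⟩, ⟨1, one_ne_zero, by simp⟩⟩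

lemma actsOnLetters_phaseGate : ActsOnLetters phaseGate phaseLetter := by
  rintro ⟨x, z⟩
  have key : ∀ x z : Fin 2,
      pauliOp (phaseLetter (x, z)) * phaseGate.map star =
        (Complex.I ^ (x : ℕ)) • (phaseGate.map star * pauliOp (x, z)) ∧
      star phaseGate * pauliOp (phaseLetter (x, z)) =
        ((-Complex.I) ^ (x : ℕ)) • (pauliOp (x, z) * star phaseGate) := by
    intro x z
    constructor <;> ext i j <;> fin_cases x <;> fin_cases z <;> fin_cases i <;> fin_cases j <;>
      simp [pauliOp, phaseGate, phaseLetter, pauliX, pauliZ, Matrix.mul_apply, Fin.sum_univ_two,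
        Matrix.vecMul, dotProduct,
        Matrix.star_apply]
  refine ⟨⟨_, ?_, (key x z).1⟩, ⟨_, ?_, (key x z).2⟩⟩
  · exact pow_ne_zero _ Complex.I_ne_zero
  · exact pow_ne_zero _ (neg_ne_zero.2 Complex.I_ne_zero)

lemma actsOnLetters_sqrtXGate : ActsOnLetters sqrtXGate sqrtXLetter := by
  rintro ⟨x, z⟩
  have key : ∀ x z : Fin 2,
      pauliOp (sqrtXLetter (x, z)) * sqrtXGate.map star =
        (Complex.I ^ (z : ℕ)) • (sqrtXGate.map star * pauliOp (x, z)) ∧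
      star sqrtXGate * pauliOp (sqrtXLetter (x, z)) =
        ((-Complex.I) ^ (z : ℕ)) • (pauliOp (x, z) * star sqrtXGate) := by
    intro x z
    constructor <;> ext i j <;> fin_cases x <;> fin_cases z <;> fin_cases i <;> fin_cases j <;>
      simp [pauliOp, sqrtXGate, sqrtXLetter, pauliX, pauliZ, Matrix.mul_apply, Fin.sum_univ_two,
        Matrix.vecMul, dotProduct,
        Matrix.star_apply, Complex.ext_iff]
  exact ⟨⟨_, pow_ne_zero _ Complex.I_ne_zero, (key x z).1⟩,
    ⟨_, pow_ne_zero _ (neg_ne_zero.2 Complex.I_ne_zero), (key x z).2⟩⟩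

/-- These new coefficients are the ones that undo gates U at A and W at B, cf.
`map_star_transpose_cancel`; the letters follow the gates. -/
lemma PauliRel.conj {K U W : Op1} {g h : Fin 2 × Fin 2 → Fin 2 × Fin 2} (hU : ActsOnLetters U g)
    (hW : ActsOnLetters W h) {a b : Fin 2 × Fin 2} (hK : PauliRel K a b) :
    PauliRel (U.map star * K * star W) (g a) (h b) := by
  obtain ⟨c, hc, hK⟩ := hK
  obtain ⟨d, hd, hd'⟩ := (hU a).1
  obtain ⟨e, he, he'⟩ := (hW b).2
  refine ⟨d * e * c, mul_ne_zero (mul_ne_zero hd he) hc, ?_⟩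
  calc pauliOp (g a) * (U.map star * K * star W) * pauliOp (h b)
      = (pauliOp (g a) * U.map star) * K * (star W * pauliOp (h b)) := by simp only [mul_assoc]
    _ = (d * e) • (U.map star * (pauliOp a * K * pauliOp b) * star W) := by
        rw [hd', he', Matrix.smul_mul, smul_mul_smul_comm]
        simp only [mul_assoc]
    _ = _ := by rw [hK, Matrix.mul_smul, Matrix.smul_mul, smul_smul]

lemma map_star_transpose_cancel {U W : Op1} (hU : IsClifford U) (hW : IsClifford W) (K : Op1) :
    U.transpose * (U.map star * K * star W) * W = K := by
  have h1 : U.transpose * U.map star = 1 := by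
    have := congrArg Matrix.transpose (Matrix.mem_unitaryGroup_iff'.1 hU.1)
    rw [Matrix.transpose_mul, Matrix.transpose_one] at this
    exact this
  have h2 := Matrix.mem_unitaryGroup_iff'.1 hW.1
  calc U.transpose * (U.map star * K * star W) * W
      = (U.transpose * U.map star) * K * (star W * W) := by simp only [mul_assoc]
    _ = K := by rw [h1, h2, one_mul, mul_one]

/-- Two Pauli letters which generate all of them. -/
def LettersIndep (b d : Fin 2 × Fin 2) : Prop := b ≠ 0 ∧ d ≠ 0 ∧ b ≠ d

instance (b d : Fin 2 × Fin 2) : Decidable (LettersIndep b d) := by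
  unfold LettersIndep; infer_instance

-- Among the three nonzero letters a, c, a + c occur both X and Z, and relations can be added.
set_option synthInstance.maxSize 1024 in
lemma exists_pauliRel_X_Z {K : Op1} {a b c d : Fin 2 × Fin 2} (hac : LettersIndep a c)
    (hbd : LettersIndep b d) (h₁ : PauliRel K a b) (h₂ : PauliRel K c d) :
    ∃ b' d', LettersIndep b' d' ∧ PauliRel K (1, 0) b' ∧ PauliRel K (0, 1) d' := by
  have h₃ := h₁.add h₂
  have hsum : ∀ b d, LettersIndep b d → LettersIndep b (b + d) ∧ LettersIndep (b + d) d ∧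
      LettersIndep d b ∧ LettersIndep (b + d) b ∧ LettersIndep d (b + d) := by decide
  obtain ⟨e1, e2, e3, e4, e5⟩ := hsum b d hbd
  have hcases : ∀ a c, LettersIndep a c → (a = (1, 0) ∧ c = (0, 1)) ∨ (a = (0, 1) ∧ c = (1, 0)) ∨
      (a = (1, 0) ∧ a + c = (0, 1)) ∨ (a + c = (1, 0) ∧ a = (0, 1)) ∨
      (c = (1, 0) ∧ a + c = (0, 1)) ∨ (a + c = (1, 0) ∧ c = (0, 1)) := by decide
  rcases hcases a c hac with ⟨h, h'⟩ | ⟨h, h'⟩ | ⟨h, h'⟩ | ⟨h, h'⟩ | ⟨h, h'⟩ | ⟨h, h'⟩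
  · exact ⟨b, d, hbd, h ▸ h₁, h' ▸ h₂⟩
  · exact ⟨d, b, e3, h' ▸ h₂, h ▸ h₁⟩
  · exact ⟨b, b + d, e1, h ▸ h₁, h' ▸ h₃⟩
  · exact ⟨b + d, b, e4, h ▸ h₃, h' ▸ h₁⟩
  · exact ⟨d, b + d, e5, h ▸ h₂, h' ▸ h₃⟩
  · exact ⟨b + d, d, e2, h ▸ h₃, h' ▸ h₂⟩

lemma eq_smul_bellCoeff_of_pauliRel {K : Op1} (hK : K ≠ 0) (hX : PauliRel K (1, 0) (0, 1))
    (hZ : PauliRel K (0, 1) (1, 0)) :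
    ∃ k s t : ℂ, k ≠ 0 ∧ (s = 1 ∨ s = -1) ∧ (t = 1 ∨ t = -1) ∧ K = k • bellCoeff s t := by
  obtain ⟨c, hc, hX⟩ := hX
  obtain ⟨d, hd, hZ⟩ := hZ
  have x00 := congrFun (congrFun hX 0) 0
  have x01 := congrFun (congrFun hX 0) 1
  have x10 := congrFun (congrFun hX 1) 0
  have z00 := congrFun (congrFun hZ 0) 0
  have z01 := congrFun (congrFun hZ 0) 1
  simp [pauliOp, pauliX, pauliZ, Matrix.mul_apply, Matrix.vecMul, dotProduct,
    Fin.sum_univ_two] at x00 x01 x10 z00 z01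
  have h11 : K 1 1 = -(c * d) * K 0 0 := by linear_combination -x01 - c * z00
  have h0 : K 0 0 ≠ 0 := by
    intro h0
    refine hK ?_
    rw [h0, mul_zero] at x00 z00 h11
    ext i j
    fin_cases i <;> fin_cases j <;> simp [h0, x00, z00, h11]
  have hsq : ∀ e : ℂ, K 0 0 = e * (e * K 0 0) → e = 1 ∨ e = -1 := by
    intro e he
    refine sq_eq_one_iff.1 ?_
    exact mul_right_cancel₀ h0 (by linear_combination -he)
  -- The scalars of the two relations are the eigenvalues: each relation links two entries of K in
  -- both directions, so c and d square to 1.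
  refine ⟨K 0 0, c, d, h0, hsq c (x00 ▸ x10), hsq d (z00 ▸ z01), ?_⟩
  ext i j
  fin_cases i <;> fin_cases j <;> simp [bellCoeff, x00, z00, h11] <;> ring

lemma diag_or_offDiag_of_pauliRel {K : Op1} (hZ : PauliRel K (0, 1) (0, 1)) :
    (K 0 0 = 0 ∧ K 1 1 = 0) ∨ (K 0 1 = 0 ∧ K 1 0 = 0) := by
  obtain ⟨c, -, hZ⟩ := hZ
  have z00 := congrFun (congrFun hZ 0) 0
  have z01 := congrFun (congrFun hZ 0) 1
  have z10 := congrFun (congrFun hZ 1) 0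
  have z11 := congrFun (congrFun hZ 1) 1
  simp [pauliOp, pauliZ, Matrix.mul_apply, Matrix.vecMul, dotProduct,
    Fin.sum_univ_two] at z00 z01 z10 z11
  by_cases hc : c = 1
  · subst hc
    right
    constructor
    · linear_combination (-1 / 2 : ℂ) * z01
    · linear_combination (-1 / 2 : ℂ) * z10
  · left
    have hc' : c - 1 ≠ 0 := sub_ne_zero.2 hc
    constructor
    · exact (mul_eq_zero.1 (show (c - 1) * K 0 0 = 0 by linear_combination -z00)).resolve_left hc'
    · exact (mul_eq_zero.1 (show (c - 1) * K 1 1 = 0 by linear_combination -z11)).resolve_left hc'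

/-! ### Local complementation of fusions -/

section Walk

variable {V : Type*} [Fintype V] [DecidableEq V] {A B : V}

/-- Some contraction of `A, B` that pairs the Pauli letters `X, Z` of `A` with the letters `b, d`
of `B` maps the graph state of `G` to `φ`, up to local Clifford gates. -/
def Fusable (A B : V) (φ : QState (Rest A B)) (G : SimpleGraph V) (b d : Fin 2 × Fin 2) : Prop :=
  ∃ K, PauliRel K (1, 0) b ∧ PauliRel K (0, 1) d ∧ LCEquiv (fuse A B K (graphState G)) φ

open Classical in
/-- The action on Pauli letters at `u` of the local complementation at `v`. -/
noncomputable def complementLetter (G : SimpleGraph V) (v u : V) :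
    Fin 2 × Fin 2 → Fin 2 × Fin 2 :=
  if u = v then sqrtXLetter else if G.Adj v u then phaseLetter else id

lemma actsOnLetters_complementGate {V : Type*} [DecidableEq V] (G : SimpleGraph V) (v u : V) :
    ActsOnLetters (complementGate G v u) (complementLetter G v u) := by
  unfold complementGate complementLetter
  split_ifs
  exacts [actsOnLetters_sqrtXGate, actsOnLetters_phaseGate, actsOnLetters_one]

lemma exists_fuse_localComplement (hAB : A ≠ B) {φ : QState (Rest A B)} {G : SimpleGraph V}
    {K : Op1} (hK : LCEquiv (fuse A B K (graphState G)) φ) (v : V) :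
    ∃ K', (∀ a b, PauliRel K a b →
        PauliRel K' (complementLetter G v A a) (complementLetter G v B b)) ∧
      LCEquiv (fuse A B K' (graphState (localComplement G v))) φ := by
  obtain ⟨c, hc, hG⟩ := exists_graphState_localComplement G v
  refine ⟨(complementGate G v A).map star * K * star (complementGate G v B), fun a b h =>
    h.conj (actsOnLetters_complementGate G v A) (actsOnLetters_complementGate G v B),
    LCEquiv.trans ?_ hK⟩
  rw [hG, fuse_smul, fuse_localOp hAB,
    map_star_transpose_cancel (isClifford_complementGate G v A) (isClifford_complementGate G v B)]
  exact ⟨_, fun u => isClifford_complementGate G v u, c, hc, rfl⟩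

variable {φ : QState (Rest A B)} {G : SimpleGraph V} {b d : Fin 2 × Fin 2}

/-- The gate at A fixes the letter X and sends Z to XZ; adding the two relations restores the basis
X, Z. -/
lemma Fusable.localComplement_left (hAB : A ≠ B) (h : Fusable A B φ G b d) :
    Fusable A B φ (localComplement G A) (complementLetter G A B b)
      (complementLetter G A B b + complementLetter G A B d) := by
  obtain ⟨K, hb, hd, hK⟩ := h
  obtain ⟨K', hrel, hK'⟩ := exists_fuse_localComplement hAB hK A
  have h1 := hrel _ _ hb
  have h2 := hrel _ _ hd
  have hg : complementLetter G A A = sqrtXLetter := if_pos rfl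
  have hX : sqrtXLetter (1, 0) = (1, 0) := by decide
  have hZ : (1, 0) + sqrtXLetter (0, 1) = (0, 1) := by decide
  rw [hg, hX] at h1
  rw [hg] at h2
  have h3 := h1.add h2
  rw [hZ] at h3
  exact ⟨K', h1, h3, hK'⟩

/-- Here A receives a phase gate, which fixes Z and sends X to XZ, so now the relation for X is
restored by adding. -/
lemma Fusable.localComplement_of_adj_left (hAB : A ≠ B) (h : Fusable A B φ G b d) {v : V}
    (hv : G.Adj v A) :
    Fusable A B φ (localComplement G v)
      (complementLetter G v B b + complementLetter G v B d) (complementLetter G v B d) := by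
  obtain ⟨K, hb, hd, hK⟩ := h
  obtain ⟨K', hrel, hK'⟩ := exists_fuse_localComplement hAB hK v
  have h1 := hrel _ _ hb
  have h2 := hrel _ _ hd
  have hg : complementLetter G v A = phaseLetter := by
    rw [complementLetter, if_neg hv.ne', if_pos hv]
  have hX : phaseLetter (1, 0) + (0, 1) = (1, 0) := by decide
  have hZ : phaseLetter (0, 1) = (0, 1) := by decide
  rw [hg] at h1
  rw [hg, hZ] at h2
  have h3 := h1.add h2
  rw [hX] at h3
  exact ⟨K', h3, h2, hK'⟩

lemma Fusable.localComplement_of_not_adj_left (hAB : A ≠ B) (h : Fusable A B φ G b d) {v : V}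
    (hvA : A ≠ v) (hv : ¬ G.Adj v A) :
    Fusable A B φ (localComplement G v) (complementLetter G v B b) (complementLetter G v B d) := by
  obtain ⟨K, hb, hd, hK⟩ := h
  obtain ⟨K', hrel, hK'⟩ := exists_fuse_localComplement hAB hK v
  have h1 := hrel _ _ hb
  have h2 := hrel _ _ hd
  have hg : complementLetter G v A = id := by rw [complementLetter, if_neg hvA, if_neg hv]
  rw [hg] at h1 h2
  exact ⟨K', h1, h2, hK'⟩

lemma LettersIndep.complementLetter {V : Type*} [DecidableEq V] {b d : Fin 2 × Fin 2}
    (h : LettersIndep b d) (G : SimpleGraph V) (v u : V) :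
    LettersIndep (complementLetter G v u b) (complementLetter G v u d) := by
  have h1 : ∀ b d, LettersIndep b d → LettersIndep (sqrtXLetter b) (sqrtXLetter d) := by decide
  have h2 : ∀ b d, LettersIndep b d → LettersIndep (phaseLetter b) (phaseLetter d) := by decide
  unfold GraphFusion.complementLetter
  split_ifs
  exacts [h1 _ _ h, h2 _ _ h, h]

lemma Fusable.exists_localComplement (hAB : A ≠ B) (h : Fusable A B φ G b d)
    (hbd : LettersIndep b d) (v : V) :
    ∃ b' d', LettersIndep b' d' ∧ Fusable A B φ (localComplement G v) b' d' := by
  have h1 : ∀ b d, LettersIndep b d → LettersIndep b (b + d) := by decide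
  have h2 : ∀ b d, LettersIndep b d → LettersIndep (b + d) d := by decide
  have hi := hbd.complementLetter G v B
  by_cases hvA : A = v
  · subst hvA
    exact ⟨_, _, h1 _ _ hi, h.localComplement_left hAB⟩
  · by_cases hadj : G.Adj v A
    · exact ⟨_, _, h2 _ _ hi, h.localComplement_of_adj_left hAB hadj⟩
    · exact ⟨_, _, hi, h.localComplement_of_not_adj_left hAB hvA hadj⟩

lemma Fusable.ne_zero (h : Fusable A B φ G b d) (hφ : φ ≠ 0) :
    ∃ K, K ≠ 0 ∧ PauliRel K (1, 0) b ∧ PauliRel K (0, 1) d ∧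
      LCEquiv (fuse A B K (graphState G)) φ := by
  obtain ⟨K, hb, hd, hK⟩ := h
  refine ⟨K, ?_, hb, hd, hK⟩
  rintro rfl
  exact hK.ne_zero hφ (by funext y; simp [fuse])

/-- Every contraction of the graph state of `G` with a joint eigenvector of `X ⊗ Z` and `Z ⊗ X`
vanishes or is `φ` up to local Clifford gates. -/
def BellFuses (A B : V) (φ : QState (Rest A B)) (G : SimpleGraph V) : Prop :=
  ∀ s t : ℤˣ, fuse A B (bellCoeff (s : ℤ) (t : ℤ)) (graphState G) = 0 ∨
    LCEquiv (fuse A B (bellCoeff (s : ℤ) (t : ℤ)) (graphState G)) φ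

lemma int_units_cast_eq (s : ℤˣ) : ((s : ℤ) : ℂ) = 1 ∨ ((s : ℤ) : ℂ) = -1 := by
  rcases Int.units_eq_one_or s with rfl | rfl <;> simp

lemma bellFuses_of_lcEquiv_fusedGraph (hAB : A ≠ B) (hG : ¬ G.Adj A B)
    (h : LCEquiv (graphState (fusedGraph A B G)) φ) : BellFuses A B φ G := fun s t =>
  .inr ((lcEquiv_fuse_bellCoeff hAB G hG (int_units_cast_eq s) (int_units_cast_eq t)).trans h)

/-- The swap forces K to be one of the target eigenvectors up to a scalar. A single such contraction
identifies φ with the fused graph state, and with it every outcome. -/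
lemma Fusable.bellFuses (hAB : A ≠ B) (hφ : φ ≠ 0) (hG : ¬ G.Adj A B)
    (h : Fusable A B φ G (0, 1) (1, 0)) : BellFuses A B φ G := by
  obtain ⟨K, hK0, hb, hd, hK⟩ := h.ne_zero hφ
  obtain ⟨k, s, t, hk, hs, ht, rfl⟩ := eq_smul_bellCoeff_of_pauliRel hK0 hb hd
  rw [smul_fuse] at hK
  refine bellFuses_of_lcEquiv_fusedGraph hAB hG ?_
  exact (lcEquiv_fuse_bellCoeff hAB G hG hs ht).symm.trans
    ((LCEquiv.of_smul (inv_ne_zero hk) (by rw [smul_smul, inv_mul_cancel₀ hk, one_smul])).trans hK)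

lemma Fusable.bellFuses_of_twins (hAB : A ≠ B) (hφ : φ ≠ 0) (hG : ¬ G.Adj A B)
    (htw : ∀ w, G.Adj A w ↔ G.Adj B w) (h : Fusable A B φ G (1, 0) (0, 1)) :
    BellFuses A B φ G := by
  obtain ⟨K, -, hd, hK⟩ := h
  refine bellFuses_of_lcEquiv_fusedGraph hAB hG ?_
  rw [fusedGraph_of_twins G htw]
  exact (lcEquiv_fuse_of_twins hAB G hG htw (diag_or_offDiag_of_pauliRel hd)
    (hK.ne_zero hφ)).symm.trans hK

lemma Fusable.bellFuses_of_isolated (hAB : A ≠ B) (hφ : φ ≠ 0)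
    (hA : ∀ w : Rest A B, ¬ G.Adj A w) (hB : ∀ w : Rest A B, ¬ G.Adj B w)
    (h : Fusable A B φ G b d) : BellFuses A B φ G := by
  have hiso := exists_fuse_eq_smul_of_isolated hAB G hA hB
  obtain ⟨K, -, -, hK⟩ := h
  obtain ⟨c, hc⟩ := hiso K
  have hc0 : c ≠ 0 := by
    rintro rfl
    exact hK.ne_zero hφ (by rw [hc, zero_smul])
  rw [hc] at hK
  have hrest : LCEquiv (graphState (restGraph A B G)) φ :=
    LCEquiv.trans (.of_smul (inv_ne_zero hc0)
      (by rw [smul_smul, inv_mul_cancel₀ hc0, one_smul])) hK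
  intro s t
  obtain ⟨e, he⟩ := hiso (bellCoeff (s : ℤ) (t : ℤ))
  by_cases he0 : e = 0
  · left; rw [he, he0, zero_smul]
  · right; exact (LCEquiv.of_smul he0 he).trans hrest

/-! ### Reaching the fusion of `X ⊗ Z` and `Z ⊗ X` -/

/-- The two moves are transvections generating GL₂(F₂); each of its six elements is within three
moves of the swap. -/
lemma walk_left {Q : Fin 2 × Fin 2 → Fin 2 × Fin 2 → Prop} (h₁ : ∀ b d, Q b d → Q b (b + d))
    (h₂ : ∀ b d, Q b d → Q (b + d) d) (hbd : LettersIndep b d) (h : Q b d) : Q (0, 1) (1, 0) := by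
  have hcases : ∀ b d, LettersIndep b d →
      (b = (0, 1) ∧ d = (1, 0)) ∨ (b = (0, 1) ∧ b + d = (1, 0)) ∨
      (b + d = (0, 1) ∧ d = (1, 0)) ∨ (b + d = (0, 1) ∧ b + d + d = (1, 0)) ∨
      (b + (b + d) = (0, 1) ∧ b + d = (1, 0)) ∨
      (b + (b + d) = (0, 1) ∧ b + (b + d) + (b + d) = (1, 0)) := by decide
  rcases hcases b d hbd with ⟨e, e'⟩ | ⟨e, e'⟩ | ⟨e, e'⟩ | ⟨e, e'⟩ | ⟨e, e'⟩ | ⟨e, e'⟩ <;>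
    rw [← e, ← e']
  exacts [h, h₁ _ _ h, h₂ _ _ h, h₁ _ _ (h₂ _ _ h), h₂ _ _ (h₁ _ _ h),
    h₁ _ _ (h₂ _ _ (h₁ _ _ h))]

lemma walk_right {Q : Fin 2 × Fin 2 → Fin 2 × Fin 2 → Prop}
    (h₁ : ∀ b d, Q b d → Q (sqrtXLetter b) (sqrtXLetter d))
    (h₂ : ∀ b d, Q b d → Q (phaseLetter b) (phaseLetter d)) (hbd : LettersIndep b d)
    (h : Q b d) : Q (0, 1) (1, 0) := by
  have hcases : ∀ b d, LettersIndep b d →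
      (b = (0, 1) ∧ d = (1, 0)) ∨ (sqrtXLetter b = (0, 1) ∧ sqrtXLetter d = (1, 0)) ∨
      (phaseLetter b = (0, 1) ∧ phaseLetter d = (1, 0)) ∨
      (sqrtXLetter (phaseLetter b) = (0, 1) ∧ sqrtXLetter (phaseLetter d) = (1, 0)) ∨
      (phaseLetter (sqrtXLetter b) = (0, 1) ∧ phaseLetter (sqrtXLetter d) = (1, 0)) ∨
      (sqrtXLetter (phaseLetter (sqrtXLetter b)) = (0, 1) ∧
        sqrtXLetter (phaseLetter (sqrtXLetter d)) = (1, 0)) := by decide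
  rcases hcases b d hbd with ⟨e, e'⟩ | ⟨e, e'⟩ | ⟨e, e'⟩ | ⟨e, e'⟩ | ⟨e, e'⟩ | ⟨e, e'⟩ <;>
    rw [← e, ← e']
  exacts [h, h₁ _ _ h, h₂ _ _ h, h₁ _ _ (h₂ _ _ h), h₂ _ _ (h₁ _ _ h),
    h₁ _ _ (h₂ _ _ (h₁ _ _ h))]

-- The moves multiply by the same transvection τ from either side. The double cosets of {1, τ} in S₃
-- have sizes 2 and 4: the smaller contains the identity, the larger the swap.
set_option synthInstance.maxSize 1024 in
lemma walk_twins {Q : Fin 2 × Fin 2 → Fin 2 × Fin 2 → Prop} (h₁ : ∀ b d, Q b d → Q b (b + d))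
    (h₂ : ∀ b d, Q b d → Q (sqrtXLetter b) (sqrtXLetter d)) (hbd : LettersIndep b d)
    (h : Q b d) : Q (0, 1) (1, 0) ∨ Q (1, 0) (0, 1) := by
  have hcases : ∀ b d, LettersIndep b d →
      (b = (0, 1) ∧ d = (1, 0)) ∨ (b = (0, 1) ∧ b + d = (1, 0)) ∨
      (sqrtXLetter b = (0, 1) ∧ sqrtXLetter d = (1, 0)) ∨
      (sqrtXLetter b = (0, 1) ∧ sqrtXLetter b + sqrtXLetter d = (1, 0)) ∨
      (b = (1, 0) ∧ d = (0, 1)) ∨ (b = (1, 0) ∧ b + d = (0, 1)) := by decide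
  rcases hcases b d hbd with ⟨e, e'⟩ | ⟨e, e'⟩ | ⟨e, e'⟩ | ⟨e, e'⟩ | ⟨e, e'⟩ | ⟨e, e'⟩ <;>
    rw [← e, ← e']
  exacts [.inl h, .inl (h₁ _ _ h), .inl (h₂ _ _ h), .inl (h₁ _ _ (h₂ _ _ h)), .inr h,
    .inr (h₁ _ _ h)]

lemma complementLetter_self {V : Type*} [DecidableEq V] (G : SimpleGraph V) (v : V) :
    complementLetter G v v = sqrtXLetter := if_pos rfl

lemma complementLetter_of_adj {V : Type*} [DecidableEq V] {G : SimpleGraph V} {v u : V} (h : G.Adj v u) :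
    complementLetter G v u = phaseLetter := by rw [complementLetter, if_neg h.ne', if_pos h]

lemma complementLetter_of_not_adj {V : Type*} [DecidableEq V] {G : SimpleGraph V} {v u : V} (hne : u ≠ v) (h : ¬ G.Adj v u) :
    complementLetter G v u = id := by rw [complementLetter, if_neg hne, if_neg h]

/-- Nonadjacent `A, B`, where `A` has a neighbour that is not adjacent to `B`. -/
lemma exists_bellFuses_of_private_left (hAB : A ≠ B) (hφ : φ ≠ 0) (hG : ¬ G.Adj A B) {w : V}
    (hwA : G.Adj w A) (hwB : ¬ G.Adj w B) (hbd : LettersIndep b d) (h : Fusable A B φ G b d) :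
    ∃ G', LCEquiv (graphState G') (graphState G) ∧ BellFuses A B φ G' := by
  have hwB' : B ≠ w := by rintro rfl; exact hG hwA.symm
  have hstep : ∃ H : SimpleGraph V, LCEquiv (graphState H) (graphState G) ∧ ¬ H.Adj A B ∧
      H.Adj w A ∧ ¬ H.Adj w B ∧ Fusable A B φ H (0, 1) (1, 0) := by
    -- Invariant of the walk: A, B stay nonadjacent and w stays a neighbour of A alone, so
    -- complementing at A or at w never touches the letters of B.
    refine walk_left (Q := fun b d => ∃ H : SimpleGraph V, LCEquiv (graphState H) (graphState G) ∧
      ¬ H.Adj A B ∧ H.Adj w A ∧ ¬ H.Adj w B ∧ Fusable A B φ H b d) ?_ ?_ hbd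
      ⟨G, LCEquiv.refl _, hG, hwA, hwB, h⟩
    · rintro b d ⟨H, hH, hHAB, hHA, hHB, hF⟩
      refine ⟨localComplement H A, (lcEquiv_localComplement H A).trans hH, ?_, ?_, ?_, ?_⟩
      · rwa [localComplement_adj_of_not_adj H (H.loopless.irrefl A)]
      · rw [SimpleGraph.adj_comm, localComplement_adj_of_not_adj H (H.loopless.irrefl A)]
        exact hHA.symm
      · rw [SimpleGraph.adj_comm, localComplement_adj_of_not_adj H hHAB, SimpleGraph.adj_comm]
        exact hHB
      · have := hF.localComplement_left hAB
        rwa [complementLetter_of_not_adj hAB.symm hHAB] at this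
    · rintro b d ⟨H, hH, hHAB, hHA, hHB, hF⟩
      refine ⟨localComplement H w, (lcEquiv_localComplement H w).trans hH, ?_, ?_, ?_, ?_⟩
      · rwa [SimpleGraph.adj_comm, localComplement_adj_of_not_adj H hHB, SimpleGraph.adj_comm]
      · rwa [localComplement_adj_of_not_adj H (H.loopless.irrefl w)]
      · rwa [localComplement_adj_of_not_adj H (H.loopless.irrefl w)]
      · have := hF.localComplement_of_adj_left hAB hHA
        rwa [complementLetter_of_not_adj hwB' hHB] at this
  obtain ⟨H, hH, hHAB, -, -, hF⟩ := hstep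
  exact ⟨H, hH, hF.bellFuses hAB hφ hHAB⟩

/-- Nonadjacent `A, B`, where `B` has a neighbour that is not adjacent to `A`. -/
lemma exists_bellFuses_of_private_right (hAB : A ≠ B) (hφ : φ ≠ 0) (hG : ¬ G.Adj A B) {w : V}
    (hwB : G.Adj w B) (hwA : ¬ G.Adj w A) (hbd : LettersIndep b d) (h : Fusable A B φ G b d) :
    ∃ G', LCEquiv (graphState G') (graphState G) ∧ BellFuses A B φ G' := by
  have hwA' : A ≠ w := by rintro rfl; exact hG hwB
  have hstep : ∃ H : SimpleGraph V, LCEquiv (graphState H) (graphState G) ∧ ¬ H.Adj A B ∧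
      H.Adj w B ∧ ¬ H.Adj w A ∧ Fusable A B φ H (0, 1) (1, 0) := by
    refine walk_right (Q := fun b d => ∃ H : SimpleGraph V, LCEquiv (graphState H) (graphState G) ∧
      ¬ H.Adj A B ∧ H.Adj w B ∧ ¬ H.Adj w A ∧ Fusable A B φ H b d) ?_ ?_ hbd
      ⟨G, LCEquiv.refl _, hG, hwB, hwA, h⟩
    · rintro b d ⟨H, hH, hHAB, hHB, hHA, hF⟩
      have hHBA : ¬ H.Adj B A := fun h => hHAB h.symm
      refine ⟨localComplement H B, (lcEquiv_localComplement H B).trans hH, ?_, ?_, ?_, ?_⟩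
      · rwa [SimpleGraph.adj_comm, localComplement_adj_of_not_adj H (H.loopless.irrefl B)]
      · rw [SimpleGraph.adj_comm, localComplement_adj_of_not_adj H (H.loopless.irrefl B)]
        exact hHB.symm
      · rw [SimpleGraph.adj_comm, localComplement_adj_of_not_adj H hHBA, SimpleGraph.adj_comm]
        exact hHA
      · have := hF.localComplement_of_not_adj_left hAB hAB hHBA
        rwa [complementLetter_self] at this
    · rintro b d ⟨H, hH, hHAB, hHB, hHA, hF⟩
      refine ⟨localComplement H w, (lcEquiv_localComplement H w).trans hH, ?_, ?_, ?_, ?_⟩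
      · rwa [localComplement_adj_of_not_adj H hHA]
      · rwa [localComplement_adj_of_not_adj H (H.loopless.irrefl w)]
      · rwa [localComplement_adj_of_not_adj H (H.loopless.irrefl w)]
      · have := hF.localComplement_of_not_adj_left hAB hwA' hHA
        rwa [complementLetter_of_adj hHB] at this
  obtain ⟨H, hH, hHAB, -, -, hF⟩ := hstep
  exact ⟨H, hH, hF.bellFuses hAB hφ hHAB⟩

lemma exists_bellFuses_of_twins (hAB : A ≠ B) (hφ : φ ≠ 0) (hG : ¬ G.Adj A B)
    (htw : ∀ w, G.Adj A w ↔ G.Adj B w) (hbd : LettersIndep b d) (h : Fusable A B φ G b d) :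
    ∃ G', LCEquiv (graphState G') (graphState G) ∧ BellFuses A B φ G' := by
  have hstep := walk_twins (Q := fun b d => ∃ H : SimpleGraph V,
      LCEquiv (graphState H) (graphState G) ∧ ¬ H.Adj A B ∧ (∀ w, H.Adj A w ↔ H.Adj B w) ∧
      Fusable A B φ H b d) ?_ ?_ hbd ⟨G, LCEquiv.refl _, hG, htw, h⟩
  · rcases hstep with ⟨H, hH, hHAB, htw', hF⟩ | ⟨H, hH, hHAB, htw', hF⟩
    · exact ⟨H, hH, hF.bellFuses hAB hφ hHAB⟩
    · exact ⟨H, hH, hF.bellFuses_of_twins hAB hφ hHAB htw'⟩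
  · rintro b d ⟨H, hH, hHAB, htw', hF⟩
    have hA : ∀ w, (localComplement H A).Adj A w ↔ H.Adj A w :=
      localComplement_adj_of_not_adj H (H.loopless.irrefl A)
    have hB : ∀ w, (localComplement H A).Adj B w ↔ H.Adj B w :=
      localComplement_adj_of_not_adj H hHAB
    refine ⟨localComplement H A, (lcEquiv_localComplement H A).trans hH, ?_, fun w => ?_, ?_⟩
    · rwa [hA]
    · rw [hA, hB, htw']
    · have := hF.localComplement_left hAB
      rwa [complementLetter_of_not_adj hAB.symm hHAB] at this
  · rintro b d ⟨H, hH, hHAB, htw', hF⟩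
    have hHBA : ¬ H.Adj B A := fun h => hHAB h.symm
    have hA : ∀ w, (localComplement H B).Adj A w ↔ H.Adj A w :=
      localComplement_adj_of_not_adj H hHBA
    have hB : ∀ w, (localComplement H B).Adj B w ↔ H.Adj B w :=
      localComplement_adj_of_not_adj H (H.loopless.irrefl B)
    refine ⟨localComplement H B, (lcEquiv_localComplement H B).trans hH, ?_, fun w => ?_, ?_⟩
    · rwa [hA]
    · rw [hA, hB, htw']
    · have := hF.localComplement_of_not_adj_left hAB hAB hHBA
      rwa [complementLetter_self] at this

lemma exists_bellFuses_of_not_adj (hAB : A ≠ B) (hφ : φ ≠ 0) (hG : ¬ G.Adj A B)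
    (hbd : LettersIndep b d) (h : Fusable A B φ G b d) :
    ∃ G', LCEquiv (graphState G') (graphState G) ∧ BellFuses A B φ G' := by
  by_cases htw : ∀ w, G.Adj A w ↔ G.Adj B w
  · exact exists_bellFuses_of_twins hAB hφ hG htw hbd h
  · push Not at htw
    obtain ⟨w, ⟨h1, h2⟩ | ⟨h1, h2⟩⟩ := htw
    · exact exists_bellFuses_of_private_left hAB hφ hG h1.symm (fun h => h2 h.symm) hbd h
    · exact exists_bellFuses_of_private_right hAB hφ hG h2.symm (fun h => h1 h.symm) hbd h

lemma exists_bellFuses_of_common (hAB : A ≠ B) (hφ : φ ≠ 0) (hG : G.Adj A B) {w : V}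
    (hwA : G.Adj w A) (hwB : G.Adj w B) (hbd : LettersIndep b d) (h : Fusable A B φ G b d) :
    ∃ G', LCEquiv (graphState G') (graphState G) ∧ BellFuses A B φ G' := by
  obtain ⟨b', d', hbd', hF⟩ := h.exists_localComplement hAB hbd w
  -- Both A and B are neighbours of w, so the edge between them is toggled away.
  have hnot : ¬ (localComplement G w).Adj A B := fun h => h.2 (by simp [hG, hwA, hwB])
  obtain ⟨G', hG', hfin⟩ := exists_bellFuses_of_not_adj hAB hφ hnot hbd' hF
  exact ⟨G', hG'.trans (lcEquiv_localComplement G w), hfin⟩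

lemma exists_bellFuses (hAB : A ≠ B) (hφ : φ ≠ 0) (hbd : LettersIndep b d)
    (h : Fusable A B φ G b d) :
    ∃ G', LCEquiv (graphState G') (graphState G) ∧ BellFuses A B φ G' := by
  by_cases hG : G.Adj A B
  swap
  · exact exists_bellFuses_of_not_adj hAB hφ hG hbd h
  by_cases hiso : (∀ w : Rest A B, ¬ G.Adj A w) ∧ ∀ w : Rest A B, ¬ G.Adj B w
  · exact ⟨G, LCEquiv.refl _, h.bellFuses_of_isolated hAB hφ hiso.1 hiso.2⟩
  have hex : ∃ w : Rest A B, G.Adj A w ∨ G.Adj B w := by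
    by_contra! hall
    exact hiso ⟨fun w => (hall w).1, fun w => (hall w).2⟩
  obtain ⟨w, hw⟩ := hex
  by_cases hA : G.Adj A w <;> by_cases hB : G.Adj B w
  · exact exists_bellFuses_of_common hAB hφ hG hA.symm hB.symm hbd h
  · obtain ⟨b', d', hbd', hF⟩ := h.exists_localComplement hAB hbd A
    have hloc : ∀ u, (localComplement G A).Adj A u ↔ G.Adj A u :=
      localComplement_adj_of_not_adj G (G.loopless.irrefl A)
    obtain ⟨G', hG', hfin⟩ := exists_bellFuses_of_common hAB hφ ((hloc B).2 hG)
      -- B and w are nonadjacent neighbours of A, so complementing at A joins them and makes w a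
      -- common neighbour.
      ((hloc w).2 hA).symm ⟨w.2.2, by simp [hG, hA, G.adj_comm w B, hB]⟩ hbd' hF
    exact ⟨G', hG'.trans (lcEquiv_localComplement G A), hfin⟩
  · obtain ⟨b', d', hbd', hF⟩ := h.exists_localComplement hAB hbd B
    have hloc : ∀ u, (localComplement G B).Adj B u ↔ G.Adj B u :=
      localComplement_adj_of_not_adj G (G.loopless.irrefl B)
    obtain ⟨G', hG', hfin⟩ := exists_bellFuses_of_common hAB hφ ((hloc A).2 hG.symm).symm
      ⟨w.2.1, by simp [hG.symm, hB, G.adj_comm w A, hA]⟩ ((hloc w).2 hB).symm hbd' hF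
    exact ⟨G', hG'.trans (lcEquiv_localComplement G B), hfin⟩
  · exact absurd hw (by simp [hA, hB])

end Walk

end GraphFusion

namespace GraphFusion

/-! ### Measurements and contractions -/

section Measure

variable {V : Type*} [Fintype V] [DecidableEq V] {A B : V}

lemma onPair_mulVec_glue (hAB : A ≠ B) (M : Op2) (ψ : QState V) (a b : Fin 2)
    (y : Rest A B → Fin 2) :
    (onPair A B M).mulVec ψ (glue A B a b y) =
      M.mulVec (fun p => ψ (glue A B p.1 p.2 y)) (a, b) := by
  have hcond : ∀ c d y', (∀ v, v ≠ A → v ≠ B → glue A B a b y v = glue A B c d y' v) ↔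
      y = y' := by
    intro c d y'
    constructor
    · intro h
      funext v
      simpa using h v v.2.1 v.2.2
    · rintro rfl v hA hB
      simp [glue, hA, hB]
  simp only [Matrix.mulVec, dotProduct]
  rw [sum_glue hAB, Fintype.sum_prod_type]
  refine Finset.sum_congr rfl fun c _ => Finset.sum_congr rfl fun d _ => ?_
  simp only [onPair, Matrix.of_apply, hcond, glue_left, glue_right hAB, ite_mul, zero_mul,
    Finset.sum_ite_eq, Finset.mem_univ, if_true]

/-- The joint eigenspace is a line spanned by a real vector of squared norm 4, so the projector is v
vᵀ / 4. -/
lemma outcomeProj_mul_outcomeProj_bell (s t : ℤˣ) (p q : Fin 2 × Fin 2) :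
    (outcomeProj (pauliX ⊗ₖ pauliZ) s * outcomeProj (pauliZ ⊗ₖ pauliX) t) p q =
      1 / 4 * bellCoeff (s : ℤ) (t : ℤ) p.1 p.2 * bellCoeff (s : ℤ) (t : ℤ) q.1 q.2 := by
  obtain ⟨a, b⟩ := p
  obtain ⟨c, d⟩ := q
  rcases Int.units_eq_one_or s with rfl | rfl <;> rcases Int.units_eq_one_or t with rfl | rfl <;>
    fin_cases a <;> fin_cases b <;> fin_cases c <;> fin_cases d <;>
    norm_num [outcomeProj, bellCoeff, pauliX, pauliZ, Matrix.mul_apply, Fintype.sum_prod_type,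
      Fin.sum_univ_two, Matrix.one_apply]

lemma projected_bell (hAB : A ≠ B) (s t : ℤˣ) (ψ : QState V) (x : V → Fin 2) :
    projected A B (pauliX ⊗ₖ pauliZ) (pauliZ ⊗ₖ pauliX) s t ψ x =
      1 / 4 * bellCoeff (s : ℤ) (t : ℤ) (x A) (x B) *
        fuse A B (bellCoeff (s : ℤ) (t : ℤ)) ψ (fun v => x v.1) := by
  conv_lhs => rw [← glue_eta hAB x]
  rw [projected, onPair_mulVec_glue hAB]
  simp only [Matrix.mulVec, dotProduct, outcomeProj_mul_outcomeProj_bell, fuse,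
    Fintype.sum_prod_type, Finset.mul_sum, mul_assoc]

lemma possible_bell_iff (hAB : A ≠ B) (s t : ℤˣ) (ψ : QState V) :
    Possible A B (pauliX ⊗ₖ pauliZ) (pauliZ ⊗ₖ pauliX) s t ψ ↔
      fuse A B (bellCoeff (s : ℤ) (t : ℤ)) ψ ≠ 0 := by
  refine not_congr ⟨fun h => ?_, fun h => ?_⟩
  · funext y
    have := congrFun h (glue A B 0 0 y)
    rw [projected_bell hAB] at this
    simpa [glue_right hAB, bellCoeff] using this
  · funext x
    rw [projected_bell hAB, h]
    simp

lemma BellFuses.fusesTo (hAB : A ≠ B) {G : SimpleGraph V} {H : SimpleGraph (Rest A B)}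
    (h : BellFuses A B (graphState H) G) {s t : ℤˣ}
    (hst : Possible A B (pauliX ⊗ₖ pauliZ) (pauliZ ⊗ₖ pauliX) s t (graphState G)) :
    FusesTo A B (pauliX ⊗ₖ pauliZ) (pauliZ ⊗ₖ pauliX) s t G H :=
  ⟨fuse A B (bellCoeff (s : ℤ) (t : ℤ)) (graphState G),
    ⟨hst, fun p => 1 / 4 * bellCoeff (s : ℤ) (t : ℤ) p.1 p.2, projected_bell hAB s t _⟩,
    (h s t).resolve_left ((possible_bell_iff hAB s t _).1 hst)⟩

lemma int_units_cast_mul_self (s : ℤˣ) : ((s : ℤ) : ℂ) * ((s : ℤ) : ℂ) = 1 := by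
  rcases Int.units_eq_one_or s with rfl | rfl <;> simp

lemma mul_outcomeProj {P : Op2} (hP : P * P = 1) (s : ℤˣ) :
    P * outcomeProj P s = ((s : ℤ) : ℂ) • outcomeProj P s := by
  have h : P * (1 + ((s : ℤ) : ℂ) • P) = ((s : ℤ) : ℂ) • (1 + ((s : ℤ) : ℂ) • P) := by
    rw [mul_add, mul_one, Matrix.mul_smul, hP, smul_add, smul_smul, int_units_cast_mul_self,
      one_smul, add_comm]
  rw [outcomeProj, Matrix.mul_smul, h, smul_comm]

lemma outcomeProj_mulVec {P : Op2} {s : ℤˣ} {β : Fin 2 × Fin 2 → ℂ}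
    (h : P.mulVec β = ((s : ℤ) : ℂ) • β) : (outcomeProj P s).mulVec β = β := by
  rw [outcomeProj, Matrix.smul_mulVec, Matrix.add_mulVec, Matrix.smul_mulVec, h, smul_smul,
    int_units_cast_mul_self, one_smul, Matrix.one_mulVec, ← two_smul ℂ β, smul_smul]
  norm_num

lemma isHermitian_outcomeProj {P : Op2} (hP : P.IsHermitian) (s : ℤˣ) :
    (outcomeProj P s).IsHermitian := by
  rw [Matrix.IsHermitian, outcomeProj, Matrix.conjTranspose_smul, Matrix.conjTranspose_add,
    Matrix.conjTranspose_smul, hP.eq, Matrix.conjTranspose_one]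
  simp

open scoped ComplexOrder in
/-- A measurement of commuting involutions that leaves the remaining qubits in a state `φ` is, up
to a scalar, the contraction with a joint eigenvector. -/
lemma Leaves.exists_fuse (hAB : A ≠ B) {P Q : Op2} (hP : P.IsHermitian) (hQ : Q.IsHermitian)
    (hP2 : P * P = 1) (hQ2 : Q * Q = 1) (hPQ : P * Q = Q * P) {s t : ℤˣ} {ψ : QState V}
    {φ : QState (Rest A B)} (h : Leaves A B P Q s t ψ φ) :
    ∃ β : Fin 2 × Fin 2 → ℂ, P.mulVec β = ((s : ℤ) : ℂ) • β ∧ Q.mulVec β = ((t : ℤ) : ℂ) • β ∧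
      ∃ c : ℂ, c ≠ 0 ∧ fuse A B (Matrix.of fun a b => star (β (a, b))) ψ = c • φ := by
  obtain ⟨hpos, β, hβ⟩ := h
  set M := outcomeProj P s * outcomeProj Q t with hM
  have hslice : ∀ y, M.mulVec (fun p => ψ (glue A B p.1 p.2 y)) = φ y • β := by
    intro y
    funext ⟨a, b⟩
    have := hβ (glue A B a b y)
    rw [projected, onPair_mulVec_glue hAB] at this
    rw [hM, this]
    simp [glue_right hAB, mul_comm]
  obtain ⟨x, hx⟩ := Function.ne_iff.1 hpos
  rw [hβ, Pi.zero_apply, mul_ne_zero_iff] at hx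
  have hcomm : outcomeProj P s * outcomeProj Q t = outcomeProj Q t * outcomeProj P s := by
    have hc : Commute P Q := hPQ
    have h1 : Commute (1 + ((s : ℤ) : ℂ) • P) (1 + ((t : ℤ) : ℂ) • Q) :=
      (Commute.one_left _).add_left
        ((Commute.one_right _).add_right ((hc.smul_left _).smul_right _))
    exact (h1.smul_left _).smul_right _
  have hPM : P * M = ((s : ℤ) : ℂ) • M := by
    rw [hM, ← mul_assoc, mul_outcomeProj hP2, Matrix.smul_mul]
  have hQM : Q * M = ((t : ℤ) : ℂ) • M := by
    rw [hM, hcomm, ← mul_assoc, mul_outcomeProj hQ2, Matrix.smul_mul]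
  -- β inherits the eigenvalue equations from the range of M, because some slice is sent by M to a
  -- nonzero multiple of β.
  have heig : ∀ (R : Op2) (r : ℂ), R * M = r • M → R.mulVec β = r • β := by
    intro R r hR
    have h1 := congrArg R.mulVec (hslice fun v => x v.1)
    rw [Matrix.mulVec_mulVec, hR, Matrix.smul_mulVec, hslice, Matrix.mulVec_smul, smul_comm] at h1
    exact (smul_right_injective _ hx.2 h1).symm
  have hPβ := heig P _ hPM
  have hQβ := heig Q _ hQM
  have hMβ : M.mulVec β = β := by
    rw [hM, ← Matrix.mulVec_mulVec, outcomeProj_mulVec hQβ, outcomeProj_mulVec hPβ]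
  have hMH : M.IsHermitian := by
    rw [Matrix.IsHermitian, hM, Matrix.conjTranspose_mul, (isHermitian_outcomeProj hP s).eq,
      (isHermitian_outcomeProj hQ t).eq, hcomm]
  have hβ0 : star β ⬝ᵥ β ≠ 0 := by
    rw [Ne, dotProduct_star_self_eq_zero]
    rintro rfl
    exact hx.1 rfl
  refine ⟨β, hPβ, hQβ, _, hβ0, ?_⟩
  funext y
  -- M is Hermitian and fixes β, so projecting before pairing with β changes nothing; the constant
  -- is then ⟨β, β⟩.
  have h1 : star β ⬝ᵥ M.mulVec (fun p => ψ (glue A B p.1 p.2 y)) =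
      star β ⬝ᵥ fun p => ψ (glue A B p.1 p.2 y) := by
    rw [Matrix.dotProduct_mulVec]
    congr 1
    conv_rhs => rw [← hMβ]
    rw [Matrix.star_mulVec, hMH.eq]
  rw [hslice, dotProduct_smul] at h1
  rw [Pi.smul_apply, smul_eq_mul, mul_comm, ← smul_eq_mul, h1]
  simp [fuse, dotProduct, Fintype.sum_prod_type]

end Measure

/-! ### Pauli measurements -/

lemma pauliOp_zero : pauliOp 0 = 1 := by simp [pauliOp]

lemma map_star_pauliOp (l : Fin 2 × Fin 2) : (pauliOp l).map star = pauliOp l := by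
  obtain ⟨x, z⟩ := l
  ext i j
  fin_cases x <;> fin_cases z <;> fin_cases i <;> fin_cases j <;>
    simp [pauliOp, pauliX, pauliZ]

lemma star_pauliOp (l : Fin 2 × Fin 2) :
    star (pauliOp l) = ((-1 : ℂ) ^ ((l.1 : ℕ) * (l.2 : ℕ))) • pauliOp l := by
  obtain ⟨x, z⟩ := l
  ext i j
  fin_cases x <;> fin_cases z <;> fin_cases i <;> fin_cases j <;>
    simp [pauliOp, pauliX, pauliZ, Matrix.star_apply]

lemma pauliRel_of_mulVec_kronecker {σ τ : Op1} {j k : ℕ} {a b : Fin 2 × Fin 2}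
    (hσ : σ = Complex.I ^ j • pauliOp a) (hτ : τ = Complex.I ^ k • pauliOp b) {s : ℤˣ}
    {β : Fin 2 × Fin 2 → ℂ} (h : (σ ⊗ₖ τ).mulVec β = ((s : ℤ) : ℂ) • β) :
    PauliRel (Matrix.of fun a b => star (β (a, b))) a b := by
  set K : Op1 := Matrix.of fun a b => star (β (a, b)) with hK
  -- The complex conjugate of the eigenvalue equation in matrix form; the index of B acts from the
  -- right, whence the adjoint of τ.
  have h1 : σ.map star * K * star τ = ((s : ℤ) : ℂ) • K := by
    ext i j
    have := congrArg star (congrFun h (i, j))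
    simp [Matrix.mulVec, dotProduct, Fintype.sum_prod_type, Fin.sum_univ_two] at this
    simp [Matrix.mul_apply, Fin.sum_univ_two, hK, Matrix.star_apply, ← this]
    ring
  have hs : ((s : ℤ) : ℂ) ≠ 0 := fun h0 => by simpa [h0] using int_units_cast_mul_self s
  have hI : ∀ n : ℕ, star (Complex.I ^ n) ≠ 0 := fun n =>
    star_ne_zero.2 (pow_ne_zero n Complex.I_ne_zero)
  set e : ℂ := star (Complex.I ^ j) * (star (Complex.I ^ k) * (-1) ^ ((b.1 : ℕ) * (b.2 : ℕ)))
    with he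
  have he0 : e ≠ 0 :=
    mul_ne_zero (hI j) (mul_ne_zero (hI k) (pow_ne_zero _ (neg_ne_zero.2 one_ne_zero)))
  have h2 : e • (pauliOp a * K * pauliOp b) = ((s : ℤ) : ℂ) • K := by
    have hmap : σ.map star = star (Complex.I ^ j) • pauliOp a := by
      ext i i'
      have h := congrFun (congrFun (map_star_pauliOp a) i) i'
      rw [Matrix.map_apply] at h
      rw [hσ, Matrix.map_apply, Matrix.smul_apply, smul_eq_mul, star_mul', h]
      rfl
    rw [← h1, hmap, hτ, star_smul, star_pauliOp, smul_smul, Matrix.smul_mul,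
      smul_mul_smul_comm]
  refine ⟨e⁻¹ * ((s : ℤ) : ℂ), mul_ne_zero (inv_ne_zero he0) hs, ?_⟩
  rw [← smul_smul, ← h2, smul_smul, inv_mul_cancel₀ he0, one_smul]

lemma pauliOp_anticomm {a c : Fin 2 × Fin 2} (h : LettersIndep a c) :
    pauliOp a * pauliOp c = -(pauliOp c * pauliOp a) := by
  -- The symplectic form of two independent letters is 1.
  have hcases : ∀ a c : Fin 2 × Fin 2, LettersIndep a c →
      (a.1 : ℕ) * (c.2 : ℕ) + a.2 * c.1 = 1 := by decide
  have h := hcases a c h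
  obtain ⟨a1, a2⟩ := a
  obtain ⟨c1, c2⟩ := c
  fin_cases a1 <;> fin_cases a2 <;> fin_cases c1 <;> fin_cases c2 <;>
    first
    | (exfalso; revert h; decide)
    | (clear h; ext i j; fin_cases i <;> fin_cases j <;> simp [pauliOp, pauliX, pauliZ])

lemma isSingleQubit_of_left {σ τ : Op1} {c : ℂ} (h : σ = c • 1) : IsSingleQubit (σ ⊗ₖ τ) :=
  ⟨c • τ, .inr (by rw [h, Matrix.smul_kronecker, Matrix.kronecker_smul])⟩

lemma isSingleQubit_of_right {σ τ : Op1} {c : ℂ} (h : τ = c • 1) : IsSingleQubit (σ ⊗ₖ τ) :=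
  ⟨c • σ, .inl (by rw [h, Matrix.smul_kronecker, Matrix.kronecker_smul])⟩

lemma kronecker_mul_self_of_isHermitian {σ τ : Op1} (hσ : σ ∈ pauliGroup) (hτ : τ ∈ pauliGroup)
    (h : (σ ⊗ₖ τ).IsHermitian) : (σ ⊗ₖ τ) * (σ ⊗ₖ τ) = 1 := by
  have h1 : σ * σ.conjTranspose = 1 :=
    Matrix.mem_unitaryGroup_iff.1 (mem_unitaryGroup_of_mem_pauliGroup hσ)
  have h2 : τ * τ.conjTranspose = 1 :=
    Matrix.mem_unitaryGroup_iff.1 (mem_unitaryGroup_of_mem_pauliGroup hτ)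
  nth_rw 2 [← h.eq]
  rw [Matrix.conjTranspose_kronecker, ← Matrix.mul_kronecker_mul, h1, h2,
    Matrix.one_kronecker_one]

/-- A fusion by Pauli measurements that are not single-qubit measurements is a contraction with
independent Pauli letters. -/
lemma exists_fusable {V : Type*} [Fintype V] [DecidableEq V] {A B : V} (hAB : A ≠ B)
    {σ₁ σ₂ σ₃ σ₄ : Op1} (hσ₁ : σ₁ ∈ pauliGroup) (hσ₂ : σ₂ ∈ pauliGroup) (hσ₃ : σ₃ ∈ pauliGroup)
    (hσ₄ : σ₄ ∈ pauliGroup) (hP : (σ₁ ⊗ₖ σ₂).IsHermitian) (hQ : (σ₃ ⊗ₖ σ₄).IsHermitian)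
    (hP1 : ¬ IsSingleQubit (σ₁ ⊗ₖ σ₂)) (hQ1 : ¬ IsSingleQubit (σ₃ ⊗ₖ σ₄))
    (hPQ1 : ¬ IsSingleQubit ((σ₁ ⊗ₖ σ₂) * (σ₃ ⊗ₖ σ₄))) {s t : ℤˣ} {G : SimpleGraph V}
    {H : SimpleGraph (Rest A B)}
    (h : FusesTo A B (σ₁ ⊗ₖ σ₂) (σ₃ ⊗ₖ σ₄) s t G H) :
    ∃ b d, LettersIndep b d ∧ Fusable A B (graphState H) G b d := by
  have hP2 := kronecker_mul_self_of_isHermitian hσ₁ hσ₂ hP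
  have hQ2 := kronecker_mul_self_of_isHermitian hσ₃ hσ₄ hQ
  obtain ⟨k₁, a, h₁⟩ := (mem_pauliGroup_iff _).1 hσ₁
  obtain ⟨k₂, b, h₂⟩ := (mem_pauliGroup_iff _).1 hσ₂
  obtain ⟨k₃, c, h₃⟩ := (mem_pauliGroup_iff _).1 hσ₃
  obtain ⟨k₄, d, h₄⟩ := (mem_pauliGroup_iff _).1 hσ₄
  have hadd : ∀ l : Fin 2 × Fin 2, l + l = 0 := by decide
  have hprod : ∀ (σ τ : Op1) (j k : ℕ) (l : Fin 2 × Fin 2), σ = Complex.I ^ j • pauliOp l →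
      τ = Complex.I ^ k • pauliOp l → ∃ e : ℂ, σ * τ = e • 1 := by
    rintro σ τ j k l rfl rfl
    obtain ⟨m, hm⟩ := pauliOp_mul l l
    rw [hadd, pauliOp_zero] at hm
    exact ⟨_, by rw [smul_mul_smul_comm, hm, smul_smul]⟩
  rw [← Matrix.mul_kronecker_mul] at hPQ1
  have hac : LettersIndep a c := by
    refine ⟨?_, ?_, ?_⟩
    · rintro rfl
      exact hP1 (isSingleQubit_of_left (pauliOp_zero ▸ h₁))
    · rintro rfl
      exact hQ1 (isSingleQubit_of_left (pauliOp_zero ▸ h₃))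
    · rintro rfl
      obtain ⟨e, he⟩ := hprod _ _ _ _ _ h₁ h₃
      exact hPQ1 (isSingleQubit_of_left he)
  have hbd : LettersIndep b d := by
    refine ⟨?_, ?_, ?_⟩
    · rintro rfl
      exact hP1 (isSingleQubit_of_right (pauliOp_zero ▸ h₂))
    · rintro rfl
      exact hQ1 (isSingleQubit_of_right (pauliOp_zero ▸ h₄))
    · rintro rfl
      obtain ⟨e, he⟩ := hprod _ _ _ _ _ h₂ h₄
      exact hPQ1 (isSingleQubit_of_right he)
  have hanti : ∀ (σ τ : Op1) (j k : ℕ) (l l' : Fin 2 × Fin 2), LettersIndep l l' →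
      σ = Complex.I ^ j • pauliOp l → τ = Complex.I ^ k • pauliOp l' → σ * τ = -(τ * σ) := by
    rintro σ τ j k l l' hl rfl rfl
    rw [smul_mul_smul_comm, smul_mul_smul_comm, pauliOp_anticomm hl, smul_neg,
      mul_comm (Complex.I ^ j)]
  -- The factors anticommute at A and at B, and the two signs cancel.
  have hPQ : (σ₁ ⊗ₖ σ₂) * (σ₃ ⊗ₖ σ₄) = (σ₃ ⊗ₖ σ₄) * (σ₁ ⊗ₖ σ₂) := by
    rw [← Matrix.mul_kronecker_mul, ← Matrix.mul_kronecker_mul, hanti _ _ _ _ _ _ hac h₁ h₃,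
      hanti _ _ _ _ _ _ hbd h₂ h₄]
    ext ⟨i, i'⟩ ⟨j, j'⟩
    simp
  obtain ⟨φ, hφ, hLC⟩ := h
  obtain ⟨β, hPβ, hQβ, e, he, hf⟩ := hφ.exists_fuse hAB hP hQ hP2 hQ2 hPQ
  obtain ⟨b', d', hbd', hX, hZ⟩ := exists_pauliRel_X_Z hac hbd
    (pauliRel_of_mulVec_kronecker h₁ h₂ hPβ) (pauliRel_of_mulVec_kronecker h₃ h₄ hQβ)
  exact ⟨b', d', hbd', _, hX, hZ, (LCEquiv.of_smul he hf).trans hLC⟩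

end GraphFusion

theorem theorem2 {V : Type*} [Fintype V] [DecidableEq V] (A B : V) (hAB : A ≠ B)
    (σ₁ σ₂ σ₃ σ₄ : Op1)
    (hσ₁ : σ₁ ∈ pauliGroup) (hσ₂ : σ₂ ∈ pauliGroup)
    (hσ₃ : σ₃ ∈ pauliGroup) (hσ₄ : σ₄ ∈ pauliGroup)
    (hP : (σ₁ ⊗ₖ σ₂).IsHermitian) (hQ : (σ₃ ⊗ₖ σ₄).IsHermitian)
    (hP1 : ¬ IsSingleQubit (σ₁ ⊗ₖ σ₂))
    (hQ1 : ¬ IsSingleQubit (σ₃ ⊗ₖ σ₄))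
    (hPQ1 : ¬ IsSingleQubit ((σ₁ ⊗ₖ σ₂) * (σ₃ ⊗ₖ σ₄)))
    (O₁ : Set (SimpleGraph V)) (hO₁ : IsGraphOrbit O₁)
    (O₂ : Set (SimpleGraph (Rest A B))) (hO₂ : IsGraphOrbit O₂)
    (G₁ : SimpleGraph V) (hG₁ : G₁ ∈ O₁)
    (G₂ : SimpleGraph (Rest A B)) (hG₂ : G₂ ∈ O₂)
    (hfuse : ∃ s t : ℤˣ,
      FusesTo A B (σ₁ ⊗ₖ σ₂) (σ₃ ⊗ₖ σ₄) s t G₁ G₂) :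
    ∃ G₁' ∈ O₁, ∃ G₂' ∈ O₂,
      (∃ s t : ℤˣ, Possible A B (pauliX ⊗ₖ pauliZ) (pauliZ ⊗ₖ pauliX)
        s t (graphState G₁')) ∧
      ∀ s t : ℤˣ, Possible A B (pauliX ⊗ₖ pauliZ) (pauliZ ⊗ₖ pauliX)
        s t (graphState G₁') →
          FusesTo A B (pauliX ⊗ₖ pauliZ) (pauliZ ⊗ₖ pauliX)
            s t G₁' G₂' := by
  obtain ⟨s, t, hst⟩ := hfuse
  obtain ⟨b, d, hbd, hF⟩ := exists_fusable hAB hσ₁ hσ₂ hσ₃ hσ₄ hP hQ hP1 hQ1 hPQ1 hst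
  obtain ⟨G', hG', hbell⟩ := exists_bellFuses hAB (graphState_ne_zero G₂) hbd hF
  obtain ⟨G₀, rfl⟩ := hO₁
  obtain ⟨s', t', h0⟩ := exists_fuse_bellCoeff_ne_zero hAB G'
  -- Only the graph on V has to be changed; `G₂` itself serves as the fused graph.
  exact ⟨G', hG'.trans hG₁, G₂, hG₂, ⟨s', t', (possible_bell_iff hAB s' t' _).2 h0⟩,
    fun s t hpos => hbell.fusesTo hAB hpos⟩
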